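/- Let $p$ be a prime, $n\ge 0$, and let $K/F$ be a cyclic Galois extension of fields of degree $p^n$ with group $G=\mathrm{Gal}(K/F)$. For $0\le i\le n$ let $K_i$ be the intermediate field of degree $p^i$ over $F$, let $G_i=\mathrm{Gal}(K_i/F)$ (a quotient of $G$), and put $$e_i(K/F)=\dim_{\mathbb F_p} N_{K_i/F}(K_i^\times)F^{\times p}/N_{K_{i+1}/F}(K_{i+1}^\times)F^{\times p}\quad(0\le i<n),\qquad e_n(K/F)=\dim_{\mathbb F_p} N_{K/F}(K^\times)F^{\times p}/F^{\times p}$$ (cardinal numbers, possibly infinite). For $m\ge 1$ let $R_m=\mathbb Z/p^m\mathbb Z$, let $J_m=K^\times/K^{\times p^m}$, regarded as an $R_mG$-module, and let $J_\infty=\varprojlim_m J_m$ (along the natural projections), regarded as a $\mathbb Z_pG$-module. A $\mathbb Z_pG_i$-module is called topologically free of rank $\kappa$ if it is isomorphic to the $p$-adic completion of a free $\mathbb Z_pG_i$-module of rank $\kappa$; for finite $\kappa$ this means free of rank $\kappa$. Suppose that $F$ contains no primitive $p$th root of unity. Then there are $\mathbb Z_pG_i$-modules $Y_i$, $0\le i\le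 n$, such that $Y_i$ is topologically free of rank $e_i(K/F)$ (hence free of rank $e_i(K/F)$ whenever $e_i(K/F)$ is finite), and $$J_\infty\simeq\bigoplus_{i=0}^n Y_i$$ as $\mathbb Z_pG$-modules. Moreover, for every $m\ge 1$, $$J_m\simeq\bigoplus_{i=0}^n Y_i/p^mY_i$$ as $R_mG$-modules, where each $Y_i/p^mY_i$ is a free $R_mG_i$-module of rank $e_i(K/F)$. -/

import Mathlib

open scoped Cardinal DirectSum

universe u v

noncomputable section

/-! ### Representations and freeness

A module over the group ring `k[G]` is given as a `k`-module `V` together with a representation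
`ρ : Representation k G V`; the `k[G]`-module itself is `ρ.asModule`. -/

namespace Representation

/-- `ρ` is a free `k[G]`-module of rank `κ`: it has a `k[G]`-basis of cardinality `κ`. -/
def IsFreeOfRank {k : Type*} {G : Type*} {V : Type*} [CommRing k] [Group G] [AddCommGroup V]
    [Module k V] (ρ : Representation k G V) (κ : Cardinal.{u}) : Prop :=
  ∃ ι : Type u, #ι = κ ∧ Nonempty (Module.Basis ι (MonoidAlgebra k G) ρ.asModule)

/-- The action of `G` on the `I`-adic completion `lim V / I ^ m V` of a representation. -/
def adicCompletion {k : Type*} {G : Type*} {V : Type*} [CommRing k] [Group G] [AddCommGroup V]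
    [Module k V] (I : Ideal k) (ρ : Representation k G V) :
    Representation k G (AdicCompletion I V) where
  toFun g := (AdicCompletion.map I (ρ g)).restrictScalars k
  map_one' := by
    rw [map_one, Module.End.one_eq_id, AdicCompletion.map_id]
    rfl
  map_mul' g h := by
    rw [map_mul, Module.End.mul_eq_comp, ← AdicCompletion.map_comp]
    rfl

/-- `ρ` is a topologically free `ℤ_p[G]`-module of rank `κ`: it is isomorphic to the `p`-adic
completion of a free `ℤ_p[G]`-module having a basis of cardinality `κ`. -/
def IsTopologicallyFreeOfRank (p : ℕ) [Fact p.Prime] {G : Type*} {V : Type*} [Group G]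
    [AddCommGroup V] [Module ℤ_[p] V] (ρ : Representation ℤ_[p] G V) (κ : Cardinal.{u}) : Prop :=
  ∃ ι : Type u, #ι = κ ∧
    Nonempty (ρ.Equiv ((free ℤ_[p] G ι).adicCompletion (Ideal.span {(p : ℤ_[p])})))

/-- The endomorphism of `V / qV` induced by an endomorphism of `V`. -/
def modNMap {V : Type*} [AddCommGroup V] (q : ℕ) (f : V →+ V) : ModN V q →+ ModN V q :=
  (Submodule.mapQ _ _ f.toIntLinearMap (by rintro _ ⟨x, rfl⟩; exact ⟨f x, by simp⟩)).toAddMonoidHom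

/-- The reduction mod `q` of a representation: the `(ℤ/qℤ)[G]`-module `V / qV`. -/
def modN {k : Type*} {G : Type*} {V : Type*} [CommRing k] [Group G] [AddCommGroup V]
    [Module k V] (ρ : Representation k G V) (q : ℕ) :
    Representation (ZMod q) G (ModN V q) where
  toFun g := (modNMap q (ρ g).toAddMonoidHom).toZModLinearMap q
  map_one' := by
    refine LinearMap.ext fun x => ?_
    obtain ⟨x, rfl⟩ := Submodule.Quotient.mk_surjective _ x
    exact congrArg Submodule.Quotient.mk (LinearMap.congr_fun (map_one ρ) x)
  map_mul' g h := by
    refine LinearMap.ext fun x => ?_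
    obtain ⟨x, rfl⟩ := Submodule.Quotient.mk_surjective _ x
    exact congrArg Submodule.Quotient.mk (LinearMap.congr_fun (map_mul ρ g h) x)

end Representation

/-! ### The layers of a cyclic extension of degree `p ^ n` -/

section Layers

variable (F : Type u) (K : Type v) [Field F] [Field K] [Algebra F K]

/-- The intermediate field `K_i` of `K/F` fixed by all `p ^ i`-th powers in `Gal(K/F)`. For a
cyclic extension of degree `p ^ n` and `i ≤ n` it is the unique intermediate field of degree
`p ^ i` over `F`, see `eq_layer_iff`. -/
def layer (p i : ℕ) : IntermediateField F K :=
  IntermediateField.fixedField (Subgroup.closure (Set.range fun g : Gal(K/F) => g ^ p ^ i))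

instance layer_normal [IsGalois F K] [IsCyclic Gal(K/F)] (p i : ℕ) : Normal F (layer F K p i) :=
  haveI := IsAbelianGalois.of_isCyclic F K
  inferInstance

variable {F K} in
theorem eq_layer_iff [FiniteDimensional F K] [IsGalois F K] [IsCyclic Gal(K/F)] {p n i : ℕ}
    (hdeg : Module.finrank F K = p ^ n) (hi : i ≤ n) (E : IntermediateField F K) :
    E = layer F K p i ↔ Module.finrank F E = p ^ i := by
  have hcard : Nat.card Gal(K/F) = p ^ n := by rw [IsGalois.card_aut_eq_finrank, hdeg]
  have key : (Subgroup.closure (Set.range fun g : Gal(K/F) => g ^ p ^ i)).index = p ^ i := by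
    let _ : CommGroup Gal(K/F) := IsCyclic.commGroup
    have h : Subgroup.closure (Set.range fun g : Gal(K/F) => g ^ p ^ i) =
        (powMonoidHom (p ^ i) : Gal(K/F) →* Gal(K/F)).range := by
      rw [← Subgroup.closure_eq (powMonoidHom (p ^ i) : Gal(K/F) →* Gal(K/F)).range]
      congr 1
    rw [h, IsCyclic.index_powMonoidHom_range, hcard, Nat.gcd_eq_right (pow_dvd_pow p hi)]
  constructor
  · rintro rfl
    rw [IntermediateField.finrank_eq_fixingSubgroup_index, layer,
      IntermediateField.fixingSubgroup_fixedField, key]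
  · intro hE
    rw [IntermediateField.finrank_eq_fixingSubgroup_index] at hE
    have hle : Subgroup.closure (Set.range fun g : Gal(K/F) => g ^ p ^ i) ≤ E.fixingSubgroup := by
      rw [Subgroup.closure_le]
      rintro _ ⟨g, rfl⟩
      have : E.fixingSubgroup.Normal :=
        ⟨fun a ha b => by
          let _ : CommGroup Gal(K/F) := IsCyclic.commGroup
          have : b * a * b⁻¹ = a := mul_inv_cancel_comm b a
          rwa [this]⟩
      have := E.fixingSubgroup.pow_index_mem g
      rwa [hE] at this
    have heq : Subgroup.closure (Set.range fun g : Gal(K/F) => g ^ p ^ i) = E.fixingSubgroup := by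
      refine Subgroup.eq_of_le_of_card_ge hle ?_
      have h1 := Subgroup.card_mul_index
        (Subgroup.closure (Set.range fun g : Gal(K/F) => g ^ p ^ i))
      have h2 := E.fixingSubgroup.card_mul_index
      rw [key] at h1
      rw [hE] at h2
      have hp : 0 < p ^ i := by
        rcases Nat.eq_zero_or_pos (p ^ i) with h0 | h0
        · rw [h0, mul_zero] at h2
          exact absurd h2.symm Nat.card_pos.ne'
        · exact h0
      exact (Nat.eq_of_mul_eq_mul_right hp (h2.trans h1.symm)).le
    rw [layer, heq, IsGalois.fixedField_fixingSubgroup]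

/-- `N_{K_i/F}(K_iˣ) Fˣᵖ` for `i ≤ n`, and `Fˣᵖ` for `i > n`. -/
def normFiltration (p n i : ℕ) : Subgroup Fˣ :=
  if i ≤ n then
    (Units.map (Algebra.norm F : layer F K p i →* F)).range ⊔ (powMonoidHom p : Fˣ →* Fˣ).range
  else (powMonoidHom p : Fˣ →* Fˣ).range

/-- `N_{K_i/F}(K_iˣ) Fˣᵖ / N_{K_{i+1}/F}(K_{i+1}ˣ) Fˣᵖ` for `i < n`, and
`N_{K/F}(Kˣ) Fˣᵖ / Fˣᵖ` for `i = n`. -/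
def NormQuotient (p n i : ℕ) : Type u :=
  Additive (normFiltration F K p n i ⧸
    (normFiltration F K p n (i + 1)).subgroupOf (normFiltration F K p n i))

instance (p n i : ℕ) : AddCommGroup (NormQuotient F K p n i) :=
  inferInstanceAs <| AddCommGroup (Additive (normFiltration F K p n i ⧸
    (normFiltration F K p n (i + 1)).subgroupOf (normFiltration F K p n i)))

instance (p n i : ℕ) : Module (ZMod p) (NormQuotient F K p n i) :=
  AddCommGroup.zmodModule (n := p) (G := NormQuotient F K p n i) (by
    intro x
    obtain ⟨y, rfl⟩ := QuotientGroup.mk_surjective (Additive.toMul (x : Additive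
      (normFiltration F K p n i ⧸
        (normFiltration F K p n (i + 1)).subgroupOf (normFiltration F K p n i))))
    refine (QuotientGroup.eq_one_iff (y ^ p)).2 ?_
    have h : (powMonoidHom p : Fˣ →* Fˣ).range ≤ normFiltration F K p n (i + 1) := by
      unfold normFiltration
      split_ifs
      · exact le_sup_right
      · exact le_rfl
    exact h ⟨y, rfl⟩)

/-- The invariant `e_i(K/F)`, `0 ≤ i ≤ n`, as a cardinal number. -/
def normRank (p n i : ℕ) : Cardinal.{u} := Module.rank (ZMod p) (NormQuotient F K p n i)

end Layers

/-! ### The modules of power classes -/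

section PowerClasses

variable (p : ℕ) (F : Type u) (K : Type v) [Field F] [Field K] [Algebra F K]

/-- `J_m = Kˣ / Kˣ^(p ^ m)`, written additively. -/
def PowerClasses (m : ℕ) : Type v := ModN (Additive Kˣ) (p ^ m)

instance (m : ℕ) : AddCommGroup (PowerClasses p K m) :=
  inferInstanceAs <| AddCommGroup (ModN (Additive Kˣ) (p ^ m))

instance (m : ℕ) : Module (ZMod (p ^ m)) (PowerClasses p K m) :=
  inferInstanceAs <| Module (ZMod (p ^ m)) (ModN (Additive Kˣ) (p ^ m))

/-- `J_m` as a `(ℤ/p ^ m)[Gal(K/F)]`-module. -/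
def powerClassesRep (m : ℕ) : Representation (ZMod (p ^ m)) Gal(K/F) (PowerClasses p K m) :=
  Representation.modN (Representation.ofMulDistribMulAction Gal(K/F) Kˣ) (p ^ m)

/-- The natural projection `J_{m+1} → J_m`. -/
def PowerClasses.proj (m : ℕ) : PowerClasses p K (m + 1) →+ PowerClasses p K m :=
  (Submodule.mapQ (LinearMap.range (LinearMap.lsmul ℤ (Additive Kˣ) (p ^ (m + 1) : ℕ)))
    (LinearMap.range (LinearMap.lsmul ℤ (Additive Kˣ) (p ^ m : ℕ))) LinearMap.id (by
      rintro _ ⟨x, rfl⟩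
      refine ⟨(p : ℤ) • x, ?_⟩
      simp [pow_succ, mul_comm _ (p : ℤ), mul_smul])).toAddMonoidHom

variable [Fact p.Prime]

/-- `ℤ_p` acts on `J_m` through `ℤ_p → ℤ/p ^ m`. -/
instance (m : ℕ) : Module ℤ_[p] (PowerClasses p K m) :=
  Module.compHom _ (PadicInt.toZModPow (p := p) m)

/-- `J_∞`, the inverse limit of the `J_m` along the natural projections. -/
def PowerClassesLimit : Submodule ℤ_[p] (∀ m, PowerClasses p K m) where
  carrier := {x | ∀ m, PowerClasses.proj p K m (x (m + 1)) = x m}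
  add_mem' hx hy m := by simp [hx m, hy m]
  zero_mem' m := by simp
  smul_mem' a x hx m := by
    have key (l : ℕ) (z : ℤ) (hz : PadicInt.toZModPow l a = z) : (a • x) l = z • x l := by
      change PadicInt.toZModPow l a • x l = z • x l
      rw [hz, Int.cast_smul_eq_zsmul]
    obtain ⟨z, hz⟩ := ZMod.intCast_surjective (PadicInt.toZModPow (m + 1) a)
    rw [key (m + 1) z hz.symm, key m z, map_zsmul, hx m]
    rw [← PadicInt.cast_toZModPow m (m + 1) m.le_succ, ← hz]
    exact ZMod.cast_intCast (pow_dvd_pow p m.le_succ) z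

/-- `J_∞` as a `ℤ_p[Gal(K/F)]`-module. -/
def powerClassesLimitRep : Representation ℤ_[p] Gal(K/F) (PowerClassesLimit p K) where
  toFun g :=
    { toFun x := ⟨fun m => powerClassesRep p F K m g (x.1 m), fun m => by
        have hx := x.2 m
        simp only [← hx]
        generalize x.1 (m + 1) = y
        obtain ⟨y, rfl⟩ := Submodule.Quotient.mk_surjective _ y
        rfl⟩
      map_add' x y := by
        ext m
        exact map_add (powerClassesRep p F K m g) _ _
      map_smul' a x := by
        ext m
        exact map_smul (powerClassesRep p F K m g) (PadicInt.toZModPow m a) _ }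
  map_one' := by
    ext x m
    exact LinearMap.congr_fun (map_one (powerClassesRep p F K m)) (x.1 m)
  map_mul' g h := by
    ext x m
    exact LinearMap.congr_fun (map_mul (powerClassesRep p F K m) g h) (x.1 m)

end PowerClasses

/-- The inflation to `Gal(K/F)` of a representation of `G_i = Gal(K_i/F)`. -/
def inflate {F : Type u} {K : Type v} [Field F] [Field K] [Algebra F K] [IsGalois F K]
    [IsCyclic Gal(K/F)] {p i : ℕ} {k : Type*} {V : Type*} [CommRing k] [AddCommGroup V] [Module k V]
    (ρ : Representation k Gal(layer F K p i/F) V) : Representation k Gal(K/F) V :=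
  ρ.comp (AlgEquiv.restrictNormalHom (layer F K p i) : Gal(K/F) →* Gal(layer F K p i/F))

end

/-! Write $M=K^\times$ additively and let $X$ act as a generator $\sigma$ of $G$, so that $M$ is a
$\mathbb Z[X]$-module. Since $\mathbb F_p[G_i]=\mathbb F_p[X]/(X-1)^{p^i}$ is a uniserial local ring
whose socle is spanned by the norm element $(X-1)^{p^i-1}$, freeness mod $p$ can be tested on fixed
classes. Two properties of $M$ enter: it has no $p$-torsion (`eq_one_of_pow_eq_one`), and Hilbert 90
holds for each $\sigma^{p^i}$ (`isHilbertModule_units`).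

The core is `IsHilbertModule.exists_norm`: a fixed class of $M/pM$ divisible by $(X-1)^{p^i}$ is the
class of a norm from $K_{i+1}$. Hence divisibility of fixed classes by powers of $X-1$ is controlled
by the norm filtration. Choose $b_{ij}\in K_i^\times$ whose norms form a basis of the $i$-th norm
quotient. A nontrivial relation mod $p$ among the $b_{ij}$, multiplied into the socle, would give
one among the norms (`exists_eq_add_of_sum_mem`). Conversely, an element killed mod $p$ by
$(X-1)^{l+1}$ can be corrected by the span of the $b_{ij}$ to one killed by $(X-1)^l$
(`mem_span_sup`).

So the equivariant map $\Phi:\bigoplus_i\mathbb Z[G_i]^{(\iota_i)}\to M$ given by the $b_{ij}$ is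
bijective mod $p$, and, as $M$ has no $p$-torsion, mod every $p^m$ (`bijective_mod_pow`). All $J_m$
are described by the same $\Phi$, so these descriptions are compatible and pass to the limit, where
the free modules become their $p$-adic completions $Y_i$. -/

noncomputable section

/-! ### Norm elements in $\mathbb Z[X]$ and their reductions mod $p$ -/

namespace CyclicModule

open Polynomial

/-- The norm element `1 + X + ⋯ + X ^ (p ^ i - 1)`. -/
def normPoly (p i : ℕ) : ℤ[X] := ∑ k ∈ Finset.range (p ^ i), X ^ k

/-- The relative norm element `∑ X ^ (p ^ i * k)`, `k < p ^ r`. -/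
def relNormPoly (p i r : ℕ) : ℤ[X] := ∑ k ∈ Finset.range (p ^ r), (X ^ p ^ i) ^ k

section Polynomials

variable (p : ℕ)

theorem sub_one_mul_normPoly (i : ℕ) : (X - 1) * normPoly p i = X ^ p ^ i - 1 := by
  rw [normPoly, mul_geom_sum]

theorem mul_relNormPoly (i r : ℕ) :
    (X ^ p ^ i - 1) * relNormPoly p i r = X ^ p ^ (i + r) - 1 := by
  rw [relNormPoly, mul_geom_sum, pow_add, pow_mul]

theorem X_sub_one_ne_zero : (X - 1 : ℤ[X]) ≠ 0 := by
  simpa using X_sub_C_ne_zero (1 : ℤ)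

theorem normPoly_mul_relNormPoly (i r : ℕ) :
    normPoly p i * relNormPoly p i r = normPoly p (i + r) := by
  apply mul_left_cancel₀ X_sub_one_ne_zero
  rw [← mul_assoc, sub_one_mul_normPoly, mul_relNormPoly, sub_one_mul_normPoly]

theorem relNormPoly_zero_left (r : ℕ) : relNormPoly p 0 r = normPoly p r := by
  simp [relNormPoly, normPoly]

variable [Fact p.Prime]

theorem natCast_dvd_iff (f : ℤ[X]) :
    (p : ℤ[X]) ∣ f ↔ f.map (Int.castRingHom (ZMod p)) = 0 := by
  have : (p : ℤ[X]) = C (p : ℤ) := by simp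
  rw [this, C_dvd_iff_dvd_coeff, Polynomial.ext_iff]
  simp [ZMod.intCast_zmod_eq_zero_iff_dvd]

theorem dvd_X_pow_sub_one_sub (i : ℕ) :
    (p : ℤ[X]) ∣ (X ^ p ^ i - 1) - (X - 1) ^ p ^ i := by
  rw [natCast_dvd_iff]
  simp [sub_pow_char_pow]

/-- In $\mathbb F_p[X]$ Frobenius turns `mul_relNormPoly` into $(X-1)^{p^i}\cdot N=(X-1)^{p^{i+r}}$,
and the nonzero factor cancels. -/
theorem dvd_relNormPoly_sub (i r : ℕ) :
    (p : ℤ[X]) ∣ relNormPoly p i r - (X - 1) ^ (p ^ i * (p ^ r - 1)) := by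
  rw [natCast_dvd_iff]
  have h1 := congrArg (Polynomial.map (Int.castRingHom (ZMod p))) (mul_relNormPoly p i r)
  have h0 : (X - 1 : (ZMod p)[X]) ^ p ^ i ≠ 0 :=
    pow_ne_zero _ (by simpa using X_sub_C_ne_zero (1 : ZMod p))
  apply mul_left_cancel₀ h0
  have h2 : (X ^ p ^ i - 1 : (ZMod p)[X]) = (X - 1) ^ p ^ i := by simp [sub_pow_char_pow]
  have h3 : (X ^ p ^ (i + r) - 1 : (ZMod p)[X]) = (X - 1) ^ p ^ (i + r) := by
    simp [sub_pow_char_pow]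
  simp only [Polynomial.map_mul, Polynomial.map_sub, Polynomial.map_pow, map_X,
    Polynomial.map_one] at h1 ⊢
  rw [h2, h3] at h1
  rw [mul_sub, h1, mul_zero, ← pow_add, sub_eq_zero]
  congr 1
  have : 1 ≤ p ^ r := Nat.one_le_pow _ _ (Fact.out : p.Prime).pos
  rw [pow_add]
  obtain ⟨c, hc⟩ := Nat.exists_eq_add_of_le this
  rw [hc, Nat.add_sub_cancel_left]; ring

theorem dvd_normPoly_sub (i : ℕ) : (p : ℤ[X]) ∣ normPoly p i - (X - 1) ^ (p ^ i - 1) := by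
  simpa [relNormPoly_zero_left] using dvd_relNormPoly_sub p 0 i

end Polynomials

/-! ### Consequences of Hilbert 90: divisible fixed classes are norms -/

variable (p n : ℕ) {M : Type*} [AddCommGroup M] [Module ℤ[X] M]

/-- The properties of the multiplicative group of a cyclic extension of degree `p ^ n` without
`p`-torsion, with `X` acting as a generator of the Galois group. -/
structure IsHilbertModule (M : Type*) [AddCommGroup M] [Module ℤ[X] M] : Prop where
  torsionFree : ∀ x : M, (p : ℤ[X]) • x = 0 → x = 0
  periodic : ∀ x : M, (X ^ p ^ n - 1 : ℤ[X]) • x = 0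
  hilbert90 : ∀ i ≤ n, ∀ w : M, relNormPoly p i (n - i) • w = 0 →
    ∃ v, w = (X ^ p ^ i - 1 : ℤ[X]) • v

/-- The submodule `pM`. -/
def multiples (M : Type*) [AddCommGroup M] [Module ℤ[X] M] : Submodule ℤ[X] M :=
  LinearMap.range (LinearMap.lsmul ℤ[X] M (p : ℤ[X]))

variable {p} in
theorem mem_multiples {x : M} : x ∈ multiples p M ↔ ∃ z, x = (p : ℤ[X]) • z := by
  simp [multiples, eq_comm]

variable {p} in
theorem smul_mem_multiples {f g : ℤ[X]} (h : (p : ℤ[X]) ∣ f - g) {x : M}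
    (hx : f • x ∈ multiples p M) : g • x ∈ multiples p M := by
  obtain ⟨c, hc⟩ := h
  have : g • x = f • x - (p : ℤ[X]) • c • x := by
    rw [smul_smul, ← hc, sub_smul]; abel
  rw [this]
  exact sub_mem hx (mem_multiples.2 ⟨_, rfl⟩)

variable {p} in
theorem sub_smul_mem_multiples {f g : ℤ[X]} (h : (p : ℤ[X]) ∣ f - g) (x : M) :
    f • x - g • x ∈ multiples p M := by
  obtain ⟨c, hc⟩ := h
  rw [← sub_smul, hc, mul_smul]
  exact mem_multiples.2 ⟨_, rfl⟩

theorem relNormPoly_smul_of_fixed {i r : ℕ} {z : M} (hz : (X ^ p ^ i - 1 : ℤ[X]) • z = 0) :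
    relNormPoly p i r • z = (p ^ r : ℤ[X]) • z := by
  have hXz : (X ^ p ^ i : ℤ[X]) • z = z := by
    rwa [sub_smul, one_smul, sub_eq_zero] at hz
  have (k : ℕ) : ((X ^ p ^ i : ℤ[X]) ^ k) • z = z := by
    induction k with
    | zero => simp
    | succ k ih => rw [pow_succ, mul_smul, hXz, ih]
  rw [relNormPoly, Finset.sum_smul, Finset.sum_congr rfl fun k _ => this k]
  simp [← Nat.cast_smul_eq_nsmul ℤ[X]]

namespace IsHilbertModule

variable {p n}
variable (h : IsHilbertModule p n M)
include h

theorem fixed_of_smul_fixed {f : ℤ[X]} {z : M} (hz : f • (p : ℤ[X]) • z = 0) : f • z = 0 :=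
  h.torsionFree _ (by rw [smul_comm, hz])

/-- A class mod `p` fixed by `X ^ p ^ i` contains an element fixed by `X ^ p ^ i`. -/
theorem exists_sub_fixed {i : ℕ} (hi : i ≤ n) {x : M}
    (hx : (X ^ p ^ i - 1 : ℤ[X]) • x ∈ multiples p M) :
    ∃ z, (X ^ p ^ i - 1 : ℤ[X]) • (x - (p : ℤ[X]) • z) = 0 := by
  obtain ⟨y, hy⟩ := mem_multiples.1 hx
  -- The relative norm of $py=(X^{p^i}-1)x$ is $(X^{p^n}-1)x=0$; without $p$-torsion the norm of $y$
  -- vanishes too.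
  obtain ⟨z, hz⟩ := h.hilbert90 i hi y (by
    apply h.torsionFree
    rw [smul_comm, ← hy, smul_smul, mul_comm, mul_relNormPoly, Nat.add_sub_cancel' hi,
      h.periodic])
  exact ⟨z, by rw [smul_sub, hy, hz, smul_comm, sub_self]⟩

variable [Fact p.Prime]

/-- Hilbert 90 for the layers. -/
theorem exists_eq_smul {i r : ℕ} (hi : i + r ≤ n) {w : M}
    (hw : relNormPoly p i r • w = 0) :
    ∃ v, w = (X ^ p ^ i - 1 : ℤ[X]) • v ∧ (X ^ p ^ (i + r) - 1 : ℤ[X]) • v = 0 := by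
  obtain ⟨s, rfl⟩ := Nat.exists_eq_add_of_le hi
  -- Transitivity of norms: the norm from the top layer to layer $i$ factors through layer $i+r$.
  have e : relNormPoly p i (i + r + s - i) = relNormPoly p (i + r) s * relNormPoly p i r := by
    have h0 : (X ^ p ^ i - 1 : ℤ[X]) ≠ 0 := by
      simpa using X_pow_sub_C_ne_zero (Nat.pow_pos (Fact.out : p.Prime).pos) (1 : ℤ)
    apply mul_left_cancel₀ h0
    rw [mul_relNormPoly, mul_left_comm, mul_relNormPoly, mul_comm, mul_relNormPoly]
    congr 3; omega
  obtain ⟨v, hv⟩ := h.hilbert90 i (by omega) w (by rw [e, mul_smul, hw, smul_zero])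
  refine ⟨v, hv, ?_⟩
  rw [← mul_relNormPoly, mul_comm, mul_smul, ← hv, hw]

/-- The relative norm $N\equiv(X-1)^{p^i(p-1)}$ kills $x$ mod $p$, because $kp^i+1\le(p-1)p^i$. So
$Nx=pz$ with $z$ in layer $i$, whence $N(x-z)=0$ and Hilbert 90 gives $x=z+(X^{p^i}-1)w$. As
$k\ge1$, applying $(X-1)^{kp^i}$ kills $z$ mod $p$ and leaves $(X-1)^{(k+1)p^i}w$. -/
theorem exists_raise {i k : ℕ} (hi : i < n) (hk : 1 ≤ k) (hkp : k + 1 < p) {x : M}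
    (hx : (X ^ p ^ (i + 1) - 1 : ℤ[X]) • x = 0)
    (hx' : (X - 1 : ℤ[X]) • ((X - 1 : ℤ[X]) ^ (k * p ^ i)) • x ∈ multiples p M) :
    ∃ w : M, (X ^ p ^ (i + 1) - 1 : ℤ[X]) • w = 0 ∧
      (X - 1 : ℤ[X]) ^ (k * p ^ i) • x - (X - 1 : ℤ[X]) ^ ((k + 1) * p ^ i) • w ∈
        multiples p M := by
  have hq : 1 ≤ p ^ i := Nat.one_le_pow _ _ (Fact.out : p.Prime).pos
  have h1 : relNormPoly p i 1 • x ∈ multiples p M := by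
    refine smul_mem_multiples ((dvd_sub_comm).1 (dvd_relNormPoly_sub p i 1)) ?_
    have : (p ^ i * (p ^ 1 - 1)) = (p ^ i * (p ^ 1 - 1) - (k * p ^ i + 1)) + 1 + k * p ^ i := by
      have : p ^ i * (p ^ 1 - 1) ≥ p ^ i * (k + 1) := Nat.mul_le_mul_left _ (by simp; omega)
      rw [mul_add, mul_comm _ k] at this
      omega
    rw [this, pow_add, pow_succ, mul_smul, mul_smul]
    exact Submodule.smul_mem _ _ hx'
  obtain ⟨z, hz⟩ := mem_multiples.1 h1
  have hz' : (X ^ p ^ i - 1 : ℤ[X]) • z = 0 := by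
    apply h.fixed_of_smul_fixed
    rw [← hz, smul_smul, mul_relNormPoly, hx]
  have hNz := relNormPoly_smul_of_fixed p (r := 1) hz'
  obtain ⟨w, hw, hw'⟩ := h.exists_eq_smul (i := i) (r := 1) (w := x - z) (by omega)
    (by rw [smul_sub, hz, hNz, pow_one, sub_self])
  refine ⟨w, hw', ?_⟩
  have hxz : x = z + (X ^ p ^ i - 1 : ℤ[X]) • w := by rw [← hw]; abel
  rw [hxz, smul_add, add_sub_assoc]
  refine add_mem ?_ ?_
  · obtain ⟨k, rfl⟩ := Nat.exists_eq_add_of_le' hk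
    rw [add_mul, one_mul, pow_add, mul_smul]
    refine Submodule.smul_mem _ _ (smul_mem_multiples (dvd_X_pow_sub_one_sub p i) ?_)
    rw [hz']; exact zero_mem _
  · rw [add_mul, one_mul, pow_add, mul_smul, ← smul_sub]
    exact Submodule.smul_mem _ _ (sub_smul_mem_multiples (dvd_X_pow_sub_one_sub p i) w)

/-- Iterates `exists_raise`. The case of interest is $k=p-1$, where $(X-1)^{kp^i}$ is the relative
norm from layer $i+1$ to layer $i$ mod $p$. -/
theorem exists_raise_top {i : ℕ} (hi : i < n) {x : M}
    (hx : (X ^ p ^ (i + 1) - 1 : ℤ[X]) • x = 0)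
    (hx' : (X - 1 : ℤ[X]) • ((X - 1 : ℤ[X]) ^ p ^ i) • x ∈ multiples p M) :
    ∀ k, 1 ≤ k → k < p → ∃ w : M, (X ^ p ^ (i + 1) - 1 : ℤ[X]) • w = 0 ∧
      (X - 1 : ℤ[X]) ^ p ^ i • x - (X - 1 : ℤ[X]) ^ (k * p ^ i) • w ∈ multiples p M := by
  intro k hk
  induction k, hk using Nat.le_induction with
  | base => exact fun _ => ⟨x, hx, by simp⟩
  | succ k hk ih =>
    intro hkp
    obtain ⟨w, hw, hw'⟩ := ih (by omega)
    obtain ⟨v, hv, hv'⟩ := h.exists_raise hi hk hkp hw (by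
      have := sub_mem hx' (Submodule.smul_mem _ (X - 1 : ℤ[X]) hw')
      rwa [smul_sub, sub_sub_cancel] at this)
    exact ⟨v, hv, by simpa using add_mem hw' hv'⟩

/-- A fixed class mod `p` divisible by `(X - 1) ^ p ^ i` is a norm from the layer `i + 1`. -/
theorem exists_norm {i : ℕ} (hi : i < n) {x y : M}
    (hy : (X - 1 : ℤ[X]) • y ∈ multiples p M)
    (hxy : y - (X - 1 : ℤ[X]) ^ p ^ i • x ∈ multiples p M) :
    ∃ u : M, (X ^ p ^ (i + 1) - 1 : ℤ[X]) • u = 0 ∧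
      y - normPoly p (i + 1) • u ∈ multiples p M := by
  have hp := (Fact.out : p.Prime).two_le
  -- replace `x` by an element of the layer `i + 1`
  obtain ⟨z, hz⟩ := h.exists_sub_fixed (i := i + 1) (by omega) (x := x) (by
    refine smul_mem_multiples (dvd_sub_comm.1 (dvd_X_pow_sub_one_sub p (i + 1))) ?_
    -- Already $(X-1)^{p^i+1}x\equiv(X-1)y\equiv0$ mod $p$, and $p^i+1\le p^{i+1}$.
    have : p ^ (i + 1) = (p ^ (i + 1) - (p ^ i + 1)) + (1 + p ^ i) := by
      have : 1 ≤ p ^ i := Nat.one_le_pow _ _ (by omega)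
      have : p ^ (i + 1) ≥ p ^ i * 2 := by rw [pow_succ]; exact Nat.mul_le_mul_left _ hp
      omega
    rw [this, pow_add, pow_add _ 1, pow_one, mul_smul, mul_smul]
    refine Submodule.smul_mem _ _ ?_
    have := sub_mem hy (Submodule.smul_mem _ (X - 1 : ℤ[X]) hxy)
    rwa [smul_sub, sub_sub_cancel] at this)
  set x' := x - (p : ℤ[X]) • z with hx'
  have hxy' : y - (X - 1 : ℤ[X]) ^ p ^ i • x' ∈ multiples p M := by
    have : y - (X - 1 : ℤ[X]) ^ p ^ i • x' =
        (y - (X - 1 : ℤ[X]) ^ p ^ i • x) + (X - 1 : ℤ[X]) ^ p ^ i • (p : ℤ[X]) • z := by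
      rw [hx', smul_sub]; abel
    rw [this]
    exact add_mem hxy (Submodule.smul_mem _ _ (mem_multiples.2 ⟨_, rfl⟩))
  obtain ⟨w, hw, hw'⟩ := h.exists_raise_top hi hz (by
    have := sub_mem hy (Submodule.smul_mem _ (X - 1 : ℤ[X]) hxy')
    rwa [smul_sub, sub_sub_cancel] at this) (p - 1) (by omega) (by omega)
  have hyw : y - relNormPoly p i 1 • w ∈ multiples p M := by
    have h2 := sub_smul_mem_multiples (dvd_relNormPoly_sub p i 1) w
    rw [pow_one, mul_comm (p ^ i)] at h2
    have := sub_mem (add_mem hxy' hw') h2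
    convert this using 1; abel
  -- adjust `w` so that its relative norm is fixed
  have htw : (X - 1 : ℤ[X]) • relNormPoly p i 1 • w ∈ multiples p M := by
    have := sub_mem hy (Submodule.smul_mem _ (X - 1 : ℤ[X]) hyw)
    rwa [smul_sub, sub_sub_cancel] at this
  obtain ⟨v, hv⟩ := h.exists_sub_fixed (i := 0) (Nat.zero_le _) (x := relNormPoly p i 1 • w)
    (by simpa using htw)
  rw [pow_zero, pow_one] at hv
  -- Both the relative norm of $w$ and its difference with $pv$ lie in layer $i$, hence so does $v$;
  -- replacing $w$ by $w-v$ then changes the norm by exactly $pv$.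
  have hv' : (X ^ p ^ i - 1 : ℤ[X]) • v = 0 := by
    apply h.fixed_of_smul_fixed
    have e : (X ^ p ^ i - 1 : ℤ[X]) • (relNormPoly p i 1 • w - (p : ℤ[X]) • v) = 0 := by
      rw [← sub_one_mul_normPoly, mul_comm, mul_smul, hv, smul_zero]
    rw [smul_sub, smul_smul, mul_relNormPoly, hw, zero_sub, neg_eq_zero] at e
    exact e
  have hNv : ∀ v : M, (X ^ p ^ i - 1 : ℤ[X]) • v = 0 →
      relNormPoly p i 1 • v = (p : ℤ[X]) • v := fun v hv => by
    rw [relNormPoly_smul_of_fixed p hv, pow_one]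
  set w' := w - v with hw'_def
  have hNw' : relNormPoly p i 1 • w' = relNormPoly p i 1 • w - (p : ℤ[X]) • v := by
    rw [hw'_def, smul_sub, hNv v hv']
  -- The relative norm of $w'$ is fixed by $X$, so that of $(X-1)w'$ is zero. The resulting $u$
  -- satisfies $(X-1)w'=(X-1)\cdot$`normPoly p i`$\cdot u$, so $w'$ differs from `normPoly p i • u`
  -- by a fixed element, whose relative norm is a multiple of $p$.
  obtain ⟨u, hu, hu'⟩ := h.exists_eq_smul (i := i) (r := 1) (w := (X - 1 : ℤ[X]) • w') (by omega)
    (by rw [smul_comm, hNw', hv])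
  refine ⟨u, hu', ?_⟩
  have hf : (X - 1 : ℤ[X]) • (w' - normPoly p i • u) = 0 := by
    rw [smul_sub, smul_smul, sub_one_mul_normPoly, hu, sub_self]
  have hf' : relNormPoly p i 1 • (w' - normPoly p i • u) =
      (p : ℤ[X]) • (w' - normPoly p i • u) :=
    hNv _ (by rw [← sub_one_mul_normPoly, mul_comm, mul_smul, hf, smul_zero])
  rw [smul_sub, smul_smul, mul_comm (relNormPoly p i 1), normPoly_mul_relNormPoly] at hf'
  rw [← sub_add_sub_cancel y (relNormPoly p i 1 • w)]
  refine add_mem hyw ?_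
  have e : relNormPoly p i 1 • w - normPoly p (i + 1) • u =
      (p : ℤ[X]) • (v + (w' - normPoly p i • u)) := by
    rw [smul_add, ← hf', hNw']; abel
  exact mem_multiples.2 ⟨_, e⟩

end IsHilbertModule

end CyclicModule

/-! ### Norm bases: independence and generation mod $p$ -/

namespace CyclicModule

open Polynomial

variable {p n : ℕ} {M : Type*} [AddCommGroup M] [Module ℤ[X] M]

/-- `W` is the filtration of the fixed elements by norms from the layers, modulo `p`, and `b i` is
a family in the `i`-th layer whose norms form a basis of `W i / W (i + 1)` over `ℤ/p`. -/
structure IsNormBasis (p n : ℕ) (W : ℕ → AddSubgroup M) {ι : Fin (n + 1) → Type*}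
    (b : ∀ i, ι i → M) : Prop where
  mem_iff : ∀ i ≤ n, ∀ y, y ∈ W i ↔ ∃ u f : M, (X ^ p ^ i - 1 : ℤ[X]) • u = 0 ∧
    (X - 1 : ℤ[X]) • f = 0 ∧ y = normPoly p i • u + (p : ℤ[X]) • f
  mem_last_iff : ∀ y, y ∈ W (n + 1) ↔ ∃ f : M, (X - 1 : ℤ[X]) • f = 0 ∧ y = (p : ℤ[X]) • f
  fixed : ∀ (i : Fin (n + 1)) (j : ι i), (X ^ p ^ (i : ℕ) - 1 : ℤ[X]) • b i j = 0
  indep : ∀ (i : Fin (n + 1)) (c : ι i →₀ ℤ),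
    Finsupp.linearCombination ℤ (fun j => normPoly p i • b i j) c ∈ W (i + 1) → ∀ j, (p : ℤ) ∣ c j
  span : ∀ (i : Fin (n + 1)), ∀ w ∈ W i, ∃ c : ι i →₀ ℤ,
    w - Finsupp.linearCombination ℤ (fun j => normPoly p i • b i j) c ∈ W (i + 1)

theorem exists_smul_of_dvd {κ : Type*} {v : κ → M} {c : κ →₀ ℤ} (hc : ∀ j, (p : ℤ) ∣ c j) :
    ∃ c' : κ →₀ ℤ, Finsupp.linearCombination ℤ v c =
      (p : ℤ[X]) • Finsupp.linearCombination ℤ v c' := by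
  choose d hd using hc
  classical
  refine ⟨Finsupp.onFinset c.support (fun j => if c j = 0 then 0 else d j) (by simp_all), ?_⟩
  rw [Nat.cast_smul_eq_nsmul, ← map_nsmul]
  congr 1
  ext j
  by_cases h : c j = 0
  · simp [h]
  · simp [hd j]

namespace IsNormBasis

variable {W : ℕ → AddSubgroup M} {ι : Fin (n + 1) → Type*} {b : ∀ i, ι i → M}
variable (hW : IsNormBasis p n W b)
include hW

theorem natCast_smul_mem {f : M} (hf : (X - 1 : ℤ[X]) • f = 0) {i : ℕ} (hi : i ≤ n + 1) :
    (p : ℤ[X]) • f ∈ W i := by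
  rcases hi.eq_or_lt with rfl | hi
  · exact (hW.mem_last_iff _).2 ⟨f, hf, rfl⟩
  · exact (hW.mem_iff i (by omega) _).2 ⟨0, f, smul_zero _, hf, by simp⟩

/-- A norm from layer $j+1$ is the norm of an element of layer $j$, by transitivity. -/
theorem le_of_le {i j : ℕ} (hij : i ≤ j) (hj : j ≤ n + 1) : W j ≤ W i := by
  induction j, hij using Nat.le_induction with
  | base => exact le_rfl
  | succ j hij ih =>
    refine le_trans (fun y hy => ?_) (ih (by omega))
    rcases hj.eq_or_lt with h | hj
    · obtain rfl : j = n := by omega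
      obtain ⟨f, hf, rfl⟩ := (hW.mem_last_iff _).1 hy
      exact hW.natCast_smul_mem hf (by omega)
    · obtain ⟨u, f, hu, hf, rfl⟩ := (hW.mem_iff _ (by omega) _).1 hy
      refine (hW.mem_iff _ (by omega) _).2 ⟨relNormPoly p j 1 • u, f, ?_, hf, ?_⟩
      · rw [smul_smul, mul_relNormPoly, hu]
      · rw [smul_smul, normPoly_mul_relNormPoly]

theorem norm_fixed (i : Fin (n + 1)) (j : ι i) :
    (X - 1 : ℤ[X]) • normPoly p i • b i j = 0 := by
  rw [smul_smul, sub_one_mul_normPoly, hW.fixed]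

theorem linearCombination_fixed (i : Fin (n + 1)) (c : ι i →₀ ℤ) :
    (X - 1 : ℤ[X]) •
      Finsupp.linearCombination ℤ (fun j => normPoly p i • b i j) c = 0 := by
  rw [Finsupp.linearCombination_apply, Finsupp.sum, Finset.smul_sum]
  refine Finset.sum_eq_zero fun j _ => ?_
  rw [smul_comm, hW.norm_fixed, smul_zero]

theorem linearCombination_mem (i : Fin (n + 1)) (c : ι i →₀ ℤ) :
    Finsupp.linearCombination ℤ (fun j => normPoly p i • b i j) c ∈ W i := by
  rw [Finsupp.linearCombination_apply, Finsupp.sum]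
  refine sum_mem fun j _ => zsmul_mem ?_ _
  exact (hW.mem_iff _ (by omega) _).2 ⟨b i j, 0, hW.fixed i j, smul_zero _, by simp⟩

/-- The sum is $pz$ with $z$ fixed, since there is no $p$-torsion. By induction on $i$, the terms of
lower index are $p$ times fixed elements and those of higher index lie in deeper steps, so the
$i$-th term is in $W_{i+1}$. -/
theorem norm_indep (hM : IsHilbertModule p n M) (c : ∀ i, ι i →₀ ℤ)
    (hc : ∑ i : Fin (n + 1),
      Finsupp.linearCombination ℤ (fun j => normPoly p i • b i j) (c i) ∈ multiples p M)
    (i : Fin (n + 1)) : ∀ j, (p : ℤ) ∣ c i j := by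
  obtain ⟨z, hz⟩ := mem_multiples.1 hc
  have hz' : (X - 1 : ℤ[X]) • z = 0 := by
    apply hM.fixed_of_smul_fixed
    rw [← hz, Finset.smul_sum]
    exact Finset.sum_eq_zero fun i _ => hW.linearCombination_fixed i _
  induction i using WellFoundedLT.induction with
  | ind i ih =>
  apply hW.indep
  rw [← Finset.add_sum_erase _ _ (Finset.mem_univ i)] at hz
  rw [eq_sub_of_add_eq hz]
  refine sub_mem (hW.natCast_smul_mem hz' (by omega)) (sum_mem fun k hk => ?_)
  rcases lt_or_gt_of_ne (Finset.ne_of_mem_erase hk) with hki | hki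
  · obtain ⟨c', hc'⟩ := exists_smul_of_dvd (v := fun j => normPoly p k • b k j) (ih k hki)
    rw [hc']
    exact hW.natCast_smul_mem (hW.linearCombination_fixed k c') (by omega)
  · exact hW.le_of_le (by have : (i : ℕ) < k := hki; omega) (by omega)
      (hW.linearCombination_mem k _)

/-- The family `b` generates `M` modulo `p`. -/
theorem mem_span_sup (hp : p.Prime) (hM : IsHilbertModule p n M) (x : M) :
    x ∈ Submodule.span ℤ[X] (⋃ i, Set.range (b i)) ⊔ multiples p M := by
  have : Fact p.Prime := ⟨hp⟩
  set S := Submodule.span ℤ[X] (⋃ i, Set.range (b i))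
  have hS (i : Fin (n + 1)) (j : ι i) : b i j ∈ S :=
    Submodule.subset_span (Set.mem_iUnion.2 ⟨i, j, rfl⟩)
  -- Norms of the $b_{ij}$ are $(X-1)^{p^i-1}b_{ij}$ mod $p$, and $l\le p^i-1$; so they can be
  -- divided by $(X-1)^l$ within $S$.
  have hWS (l : ℕ) : ∀ i, i ≤ n + 1 → l < p ^ i → ∀ w ∈ W i,
      ∃ s ∈ S, w - (X - 1 : ℤ[X]) ^ l • s ∈ multiples p M := by
    intro i hi
    induction hi using Nat.decreasingInduction with
    | self =>
      intro _ w hw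
      obtain ⟨f, -, rfl⟩ := (hW.mem_last_iff _).1 hw
      exact ⟨0, zero_mem _, by rw [smul_zero, sub_zero]; exact mem_multiples.2 ⟨_, rfl⟩⟩
    | of_succ i hi ih =>
      intro hl w hw
      obtain ⟨c, hc⟩ := hW.span ⟨i, hi⟩ w hw
      obtain ⟨s, hs, hs'⟩ := ih (hl.trans (Nat.pow_lt_pow_right hp.one_lt (by omega))) _ hc
      refine ⟨s + (X - 1 : ℤ[X]) ^ (p ^ i - 1 - l) •
        Finsupp.linearCombination ℤ (b ⟨i, hi⟩) c, add_mem hs (Submodule.smul_mem _ _ ?_), ?_⟩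
      · rw [Finsupp.linearCombination_apply, Finsupp.sum]
        exact sum_mem fun j _ => zsmul_mem (hS _ _) _
      · have e : Finsupp.linearCombination ℤ (fun j => normPoly p i • b ⟨i, hi⟩ j) c =
            normPoly p i • Finsupp.linearCombination ℤ (b ⟨i, hi⟩) c := by
          rw [Finsupp.linearCombination_apply, Finsupp.linearCombination_apply, Finsupp.sum,
            Finsupp.sum, Finset.smul_sum]
          exact Finset.sum_congr rfl fun j _ => smul_comm _ _ _
        rw [e] at hs'
        have := add_mem hs' (sub_smul_mem_multiples (dvd_normPoly_sub p i)
          (Finsupp.linearCombination ℤ (b ⟨i, hi⟩) c))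
        rw [smul_add, smul_smul, ← pow_add, Nat.add_sub_cancel' (by omega)]
        convert this using 1
        abel
  -- If $(X-1)^{l+1}x\equiv0$, then $(X-1)^lx$ is a fixed class, hence in some $W_i$ with $l<p^i$,
  -- hence $\equiv(X-1)^ls$ with $s\in S$; the induction hypothesis applies to $x-s$.
  have key (l : ℕ) : ∀ x : M, (X - 1 : ℤ[X]) ^ l • x ∈ multiples p M → x ∈ S ⊔ multiples p M := by
    induction l with
    | zero => exact fun x hx => Submodule.mem_sup_right (by simpa using hx)
    | succ l ih =>
      intro x hx
      rw [pow_succ', mul_smul] at hx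
      by_cases hl : p ^ n ≤ l
      · apply ih
        rw [← Nat.sub_add_cancel hl, pow_add, mul_smul]
        refine Submodule.smul_mem _ _ (smul_mem_multiples (dvd_X_pow_sub_one_sub p n) ?_)
        rw [hM.periodic]; exact zero_mem _
      obtain ⟨i, hi, hli, w, hw, hw'⟩ : ∃ i ≤ n, l < p ^ i ∧ ∃ w ∈ W i,
          (X - 1 : ℤ[X]) ^ l • x - w ∈ multiples p M := by
        rcases Nat.eq_zero_or_pos l with rfl | hl0
        · obtain ⟨z, hz⟩ := hM.exists_sub_fixed (i := 0) (Nat.zero_le _) (x := x)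
            (by simpa using hx)
          refine ⟨0, Nat.zero_le _, by simp, x - (p : ℤ[X]) • z,
            (hW.mem_iff 0 (Nat.zero_le _) _).2 ⟨_, 0, hz, smul_zero _, ?_⟩, ?_⟩
          · simp [normPoly]
          · rw [pow_zero, one_smul, sub_sub_cancel]; exact mem_multiples.2 ⟨_, rfl⟩
        -- With $j=\lfloor\log_pl\rfloor$ the class is divisible by $(X-1)^{p^j}$, so it is a norm
        -- from layer $j+1$, and $l<p^{j+1}$.
        · have h1 : p ^ Nat.log p l ≤ l := Nat.pow_log_le_self p hl0.ne'
          have h2 : l < p ^ (Nat.log p l + 1) := Nat.lt_pow_succ_log_self hp.one_lt l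
          have h3 : Nat.log p l < n := by
            by_contra hcon
            exact hl ((Nat.pow_le_pow_right hp.pos (by omega)).trans h1)
          obtain ⟨u, hu, hu'⟩ := hM.exists_norm h3
            (x := (X - 1 : ℤ[X]) ^ (l - p ^ Nat.log p l) • x) hx (by
              rw [smul_smul, ← pow_add, Nat.add_sub_cancel' h1, sub_self]; exact zero_mem _)
          exact ⟨_, h3, h2, _,
            (hW.mem_iff _ h3 _).2 ⟨u, 0, hu, smul_zero _, by rw [smul_zero, add_zero]⟩, hu'⟩
      obtain ⟨s, hs, hs'⟩ := hWS l i (by omega) hli w hw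
      have h1 : x - s ∈ S ⊔ multiples p M := by
        apply ih
        rw [smul_sub]
        simpa using add_mem hw' hs'
      simpa using add_mem h1 (Submodule.mem_sup_left (T := multiples p M) hs)
  refine key (p ^ n) x (smul_mem_multiples (dvd_X_pow_sub_one_sub p n) ?_)
  rw [hM.periodic]
  exact zero_mem _

/-- The coefficients of a relation modulo `p` between the elements `b i j` are trivial. -/
theorem exists_eq_add_of_sum_mem (hp : p.Prime) (hM : IsHilbertModule p n M)
    (f : ∀ i, ι i →₀ ℤ[X])
    (hf : ∑ i, Finsupp.linearCombination ℤ[X] (b i) (f i) ∈ multiples p M)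
    (i : Fin (n + 1)) (j : ι i) :
    ∃ g h, f i j = (X ^ p ^ (i : ℕ) - 1) * g + (p : ℤ[X]) * h := by
  have : Fact p.Prime := ⟨hp⟩
  let P (k : ℕ) (f : ℤ[X]) : Prop := ∃ g h, f = (X - 1) ^ k * g + (p : ℤ[X]) * h
  -- Induction on a power of $X-1$ that makes all coefficients trivial; $k=p^n$ always works.
  suffices key : ∀ k, ∀ f : ∀ i, ι i →₀ ℤ[X],
      ∑ i, Finsupp.linearCombination ℤ[X] (b i) (f i) ∈ multiples p M →
      (∀ (i : Fin (n + 1)) j, P (p ^ (i : ℕ)) ((X - 1) ^ k * f i j)) →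
      ∀ (i : Fin (n + 1)) j, P (p ^ (i : ℕ)) (f i j) by
    obtain ⟨g, h, hgh⟩ := key (p ^ n) f hf (fun i j => by
      refine ⟨(X - 1) ^ (p ^ n - p ^ (i : ℕ)) * f i j, 0, ?_⟩
      rw [← mul_assoc, ← pow_add, Nat.add_sub_cancel' (Nat.pow_le_pow_right hp.pos (by omega))]
      simp) i j
    obtain ⟨c, hc⟩ := dvd_X_pow_sub_one_sub p i
    exact ⟨g, h - c * g, by rw [hgh, eq_add_of_sub_eq hc]; ring⟩
  intro k
  induction k with
  | zero => intro f _ h; simpa using h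
  | succ k ih =>
    intro f hf hk
    have h1 (i : Fin (n + 1)) (j : ι i) : P (p ^ (i : ℕ)) ((X - 1) * f i j) := by
      refine ih (fun i => (X - 1 : ℤ[X]) • f i) ?_ (fun i j => ?_) i j
      · simp only [map_smul, ← Finset.smul_sum]
        exact Submodule.smul_mem _ _ hf
      · simpa [pow_succ, mul_assoc] using hk i j
    -- Each coefficient lies in the socle mod $p$ and $(X-1)^{p^i}$, so one integer $c$ describes
    -- it. The last clause keeps the family $c$ finitely supported.
    have h2 (i : Fin (n + 1)) (j : ι i) : ∃ (c : ℤ) (g h : ℤ[X]),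
        f i j = (X - 1) ^ (p ^ (i : ℕ) - 1) * (C c + (X - 1) * g) + (p : ℤ[X]) * h ∧
          (f i j = 0 → c = 0) := by
      by_cases h0 : f i j = 0
      · exact ⟨0, 0, 0, by simp [h0], fun _ => rfl⟩
      obtain ⟨g, h, hgh⟩ := h1 i j
      have hpi : p ^ (i : ℕ) = p ^ (i : ℕ) - 1 + 1 :=
        (Nat.sub_add_cancel (Nat.one_le_pow _ _ hp.pos)).symm
      -- Evaluation at $1$ gives $p\,h(1)=0$ in $\mathbb Z$.
      have hh : (X - 1 : ℤ[X]) ∣ h := by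
        have h3 : (X - C 1 : ℤ[X]) ∣ (p : ℤ[X]) * h := by
          refine ⟨f i j - (X - 1) ^ (p ^ (i : ℕ) - 1) * g, ?_⟩
          rw [C_1, mul_sub, hgh, hpi, Nat.add_sub_cancel, pow_succ]; ring
        rw [dvd_iff_isRoot, IsRoot, eval_mul, eval_natCast, mul_eq_zero] at h3
        simpa using dvd_iff_isRoot.2 (h3.resolve_left (by exact_mod_cast hp.ne_zero))
      obtain ⟨h', rfl⟩ := hh
      obtain ⟨g', hg'⟩ : (X - 1 : ℤ[X]) ∣ g - C (g.eval 1) := by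
        simpa using X_sub_C_dvd_sub_C_eval (a := (1 : ℤ)) (p := g)
      refine ⟨g.eval 1, g', h', mul_left_cancel₀ X_sub_one_ne_zero ?_, fun h => absurd h h0⟩
      rw [← hg', hgh]
      nth_rewrite 1 [hpi]
      rw [pow_succ]; ring
    choose c g h hf' hc0 using h2
    let c' (i : Fin (n + 1)) : ι i →₀ ℤ :=
      Finsupp.onFinset (f i).support (c i) (fun j hj => by
        rw [Finsupp.mem_support_iff]; exact fun h => hj (hc0 i j h))
    -- Mod $p$ the relation becomes $\sum c_{ij}N(b_{ij})\equiv0$, since $(X-1)^{p^i}$ kills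
    -- $b_{ij}$ mod $p$.
    have h3 : ∀ (i : Fin (n + 1)) j, (p : ℤ) ∣ c i j := by
      intro i
      refine hW.norm_indep hM c' ?_ i
      rw [← sub_sub_cancel (∑ i, Finsupp.linearCombination ℤ[X] (b i) (f i))
        (∑ i : Fin (n + 1), Finsupp.linearCombination ℤ (fun j => normPoly p i • b i j) (c' i)),
        ← Finset.sum_sub_distrib]
      refine sub_mem hf (sum_mem fun i _ => ?_)
      rw [Finsupp.linearCombination_apply, Finsupp.linearCombination_apply,
        Finsupp.sum_of_support_subset (c' i) (Finsupp.support_onFinset_subset) _ (by simp),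
        Finsupp.sum, ← Finset.sum_sub_distrib]
      refine sum_mem fun j _ => ?_
      have h4 := sub_smul_mem_multiples (dvd_normPoly_sub p i) (c i j • b i j)
      have h5 := sub_smul_mem_multiples (dvd_X_pow_sub_one_sub p i) (g i j • b i j)
      rw [smul_comm _ (g i j), hW.fixed, smul_zero] at h5
      have e : f i j • b i j - c' i j • normPoly p i • b i j =
          (p : ℤ[X]) • h i j • b i j -
          (normPoly p i • c i j • b i j - (X - 1 : ℤ[X]) ^ (p ^ (i : ℕ) - 1) • c i j • b i j) -
          (0 - (X - 1 : ℤ[X]) ^ p ^ (i : ℕ) • g i j • b i j) := by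
        have hpi : p ^ (i : ℕ) = p ^ (i : ℕ) - 1 + 1 :=
          (Nat.sub_add_cancel (Nat.one_le_pow _ _ hp.pos)).symm
        have hci : C (c i j) • b i j = c i j • b i j := by
          simp [Int.cast_smul_eq_zsmul]
        nth_rewrite 2 [hpi]
        rw [hf' i j, smul_comm (normPoly p i), pow_succ]
        change _ - c i j • _ = _
        simp only [← hci, add_smul, mul_smul, smul_add]
        abel
      rw [e]
      exact sub_mem (sub_mem (mem_multiples.2 ⟨_, rfl⟩) h4) h5
    intro i j
    obtain ⟨d, hd⟩ := h3 i j
    refine ⟨g i j, (X - 1) ^ (p ^ (i : ℕ) - 1) * C d + h i j, ?_⟩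
    have hpi : p ^ (i : ℕ) = p ^ (i : ℕ) - 1 + 1 :=
      (Nat.sub_add_cancel (Nat.one_le_pow _ _ hp.pos)).symm
    rw [hf' i j, hd, C_mul]
    nth_rewrite 2 [hpi]
    rw [pow_succ]
    simp only [map_natCast]
    ring

end IsNormBasis
end CyclicModule

/-! ### The unit group of a cyclic extension as a $\mathbb Z[X]$-module -/

namespace CyclicModule

open Polynomial

section PolyModule

variable {G V : Type*} [Group G] [AddCommGroup V] (ρ : Representation ℤ G V) (g : G)

/-- The `ℤ[X]`-module on which `X` acts as `ρ g`. -/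
@[reducible] def polyModule : Module ℤ[X] V :=
  Module.compHom V (aeval (ρ g) : ℤ[X] →ₐ[ℤ] Module.End ℤ V).toRingHom

theorem polyModule_smul (f : ℤ[X]) (x : V) :
    letI := polyModule ρ g
    f • x = aeval (ρ g) f x := rfl

theorem X_pow_smul (k : ℕ) (x : V) :
    letI := polyModule ρ g
    (X ^ k : ℤ[X]) • x = ρ (g ^ k) x := by
  rw [polyModule_smul]
  simp

end PolyModule

section Fields

variable {F : Type u} {K : Type v} [Field F] [Field K] [Algebra F K]

/-- Hilbert 90 via a resolvent: with $a_k=\prod_{j<k}\tau^jw$, Dedekind independence makes some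
$y=\sum_ka_k\tau^k\theta$ nonzero, and $w\,\tau(y)=y$ because $a_m=a_0$. -/
theorem exists_div_eq_of_prod_eq_one (τ : Gal(K/F)) {m : ℕ} (hm : orderOf τ = m) (hm0 : 0 < m)
    (w : Kˣ) (hw : ∏ k ∈ Finset.range m, (τ ^ k) • w = 1) : ∃ v : Kˣ, w = τ • v / v := by
  let a (k : ℕ) : Kˣ := ∏ j ∈ Finset.range k, (τ ^ j) • w
  have ha (k : ℕ) : w * τ • a k = a (k + 1) := by
    simp only [a]
    rw [Finset.prod_range_succ', Finset.smul_prod', mul_comm]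
    simp [pow_succ', mul_smul]
  have hinj : Function.Injective fun k : Fin m => ((τ ^ (k : ℕ) : Gal(K/F)) : K →* K) := by
    intro k l hkl
    have h1 : τ ^ (k : ℕ) = τ ^ (l : ℕ) := AlgEquiv.ext fun x => DFunLike.congr_fun hkl x
    exact Fin.ext (pow_injOn_Iio_orderOf (by simp [hm]) (by simp [hm]) h1)
  have hli := (linearIndependent_monoidHom K K).comp _ hinj
  obtain ⟨θ, hθ⟩ : ∃ θ : K, ∑ k ∈ Finset.range m, (a k : K) * (τ ^ k) θ ≠ 0 := by
    by_contra! hcon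
    have := Fintype.linearIndependent_iff.1 hli (fun k => (a k : K)) (by
      ext x
      have := hcon x
      rw [Finset.sum_range] at this
      simpa using this) ⟨0, hm0⟩
    exact (a 0).ne_zero this
  let y := Units.mk0 _ hθ
  have hy : (w : K) * τ (y : K) = y := by
    simp only [y, Units.val_mk0, map_sum, map_mul, Finset.mul_sum]
    have h1 (k : ℕ) : (w : K) * (τ (a k) * τ ((τ ^ k) θ)) = a (k + 1) * (τ ^ (k + 1)) θ := by
      rw [← mul_assoc, pow_succ', ← ha]
      rfl
    rw [Finset.sum_congr rfl fun k _ => h1 k]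
    have h2 := Finset.sum_range_succ' (fun k => (a k : K) * (τ ^ k) θ) m
    rw [Finset.sum_range_succ] at h2
    have h3 : (a m : K) * (τ ^ m) θ = (a 0 : K) * (τ ^ 0) θ := by
      have : a m = a 0 := by simp only [a, hw]; simp
      rw [this, ← hm, pow_orderOf_eq_one, pow_zero]
    rw [h3] at h2
    exact (add_right_cancel h2).symm
  refine ⟨y⁻¹, ?_⟩
  rw [smul_inv', div_inv_eq_mul, eq_inv_mul_iff_mul_eq, mul_comm]
  exact Units.ext hy

/-- The multiplicative group of `K` as a module over `ℤ[X]`, with `X` acting as `σ`. -/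
abbrev unitsModule (σ : Gal(K/F)) : Module ℤ[X] (Additive Kˣ) :=
  polyModule (Representation.ofMulDistribMulAction Gal(K/F) Kˣ) σ

theorem sum_X_pow_smul (σ : Gal(K/F)) (m e : ℕ) (w : Kˣ) :
    letI := unitsModule σ
    (∑ k ∈ Finset.range m, ((X : ℤ[X]) ^ e) ^ k) • Additive.ofMul w =
      Additive.ofMul (∏ k ∈ Finset.range m, ((σ ^ e) ^ k) • w) := by
  let _ := unitsModule σ
  rw [Finset.sum_smul, ofMul_prod]
  refine Finset.sum_congr rfl fun k _ => ?_
  rw [← pow_mul, X_pow_smul, ← pow_mul]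
  rfl

theorem X_pow_sub_one_smul_eq_zero_iff (σ : Gal(K/F)) (e : ℕ) (w : Kˣ) :
    letI := unitsModule σ
    (X ^ e - 1 : ℤ[X]) • Additive.ofMul w = 0 ↔ (σ ^ e) • w = w := by
  let _ := unitsModule σ
  rw [sub_smul, one_smul, X_pow_smul, sub_eq_zero]
  rfl

variable {p n : ℕ}

theorem mem_layer_iff {σ : Gal(K/F)} (hσ : ∀ g, g ∈ Subgroup.zpowers σ) (i : ℕ) (x : K) :
    x ∈ layer F K p i ↔ (σ ^ p ^ i) x = x := by
  rw [layer, IntermediateField.mem_fixedField_iff]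
  constructor
  · intro h
    exact h _ (Subgroup.subset_closure ⟨σ, rfl⟩)
  · intro h
    suffices Subgroup.closure (Set.range fun g : Gal(K/F) => g ^ p ^ i) ≤
      MulAction.stabilizer Gal(K/F) x from fun f hf => this hf
    rw [Subgroup.closure_le]
    rintro _ ⟨g, rfl⟩
    obtain ⟨k, rfl⟩ := hσ g
    have : (σ ^ k) ^ p ^ i = (σ ^ p ^ i) ^ k := by
      rw [← zpow_natCast, ← zpow_natCast, ← zpow_mul, ← zpow_mul, mul_comm]
    simp only [this]
    exact zpow_mem (show σ ^ p ^ i ∈ MulAction.stabilizer Gal(K/F) x from h) k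

/-- The inclusion of the units of the `i`-th layer. -/
def layerUnits (F : Type u) (K : Type v) [Field F] [Field K] [Algebra F K] (p i : ℕ) :
    (layer F K p i)ˣ →* Kˣ :=
  Units.map (algebraMap (layer F K p i) K : layer F K p i →* K)

theorem exists_layerUnits_eq_iff {σ : Gal(K/F)} (hσ : ∀ g, g ∈ Subgroup.zpowers σ) (i : ℕ)
    (x : Kˣ) : (∃ u, layerUnits F K p i u = x) ↔ (σ ^ p ^ i) • x = x := by
  rw [Units.ext_iff]
  change _ ↔ (σ ^ p ^ i) (x : K) = x
  rw [← mem_layer_iff hσ]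
  constructor
  · rintro ⟨u, rfl⟩
    exact u.1.2
  · intro hx
    exact ⟨Units.mk0 ⟨x, hx⟩ (fun h => x.ne_zero (congrArg Subtype.val h)), Units.ext rfl⟩

theorem restrictNormal_generator [IsGalois F K] [IsCyclic Gal(K/F)] {σ : Gal(K/F)}
    (hσ : ∀ g, g ∈ Subgroup.zpowers σ) (i : ℕ) :
    ∀ g, g ∈ Subgroup.zpowers (AlgEquiv.restrictNormalHom (layer F K p i) σ) := by
  intro g
  obtain ⟨g, rfl⟩ := AlgEquiv.restrictNormalHom_surjective K g
  obtain ⟨k, rfl⟩ := hσ g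
  exact ⟨k, (map_zpow _ _ _).symm⟩

variable [FiniteDimensional F K]

/-- A nontrivial root is a zero of the $p$th cyclotomic polynomial, so its degree over $F$ is less
than $p$; as it divides $p^n$ it is $1$, and the root lies in $F$. -/
theorem eq_one_of_pow_eq_one (hp : p.Prime) (hdeg : Module.finrank F K = p ^ n)
    (hF : ∀ ζ : F, ¬ IsPrimitiveRoot ζ p) {x : K} (hx : x ^ p = 1) : x = 1 := by
  by_contra hne
  have : Fact p.Prime := ⟨hp⟩
  have hroot : (Polynomial.cyclotomic p F).aeval x = 0 := by
    have h1 : (∑ k ∈ Finset.range p, x ^ k) * (x - 1) = 0 := by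
      rw [geom_sum_mul, hx, sub_self]
    rw [cyclotomic_prime]
    simpa using (mul_eq_zero.1 h1).resolve_right (sub_ne_zero.2 hne)
  have hint : IsIntegral F x := IsIntegral.of_finite F x
  have h1 : (minpoly F x).natDegree < p := by
    have := natDegree_le_of_dvd (minpoly.dvd F x hroot) (cyclotomic_ne_zero p F)
    rw [natDegree_cyclotomic, Nat.totient_prime hp] at this
    have := hp.two_le
    omega
  have h2 : (minpoly F x).natDegree ∣ p ^ n := hdeg ▸ minpoly.degree_dvd hint
  obtain ⟨k, -, hk⟩ := (Nat.dvd_prime_pow hp).1 h2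
  have hk0 : k = 0 := by
    by_contra h0
    rw [hk] at h1
    exact absurd h1 (not_lt.2 (Nat.le_self_pow h0 p))
  rw [hk0, pow_zero] at hk
  obtain ⟨ζ, rfl⟩ := minpoly.natDegree_eq_one_iff.1 hk
  refine hF ζ (IsPrimitiveRoot.of_map_of_injective (f := algebraMap F K) ?_
    (algebraMap F K).injective)
  exact (IsPrimitiveRoot.iff_orderOf.2 (orderOf_eq_prime hx hne))

variable [IsGalois F K]

theorem orderOf_generator (hdeg : Module.finrank F K = p ^ n) {σ : Gal(K/F)}
    (hσ : ∀ g, g ∈ Subgroup.zpowers σ) : orderOf σ = p ^ n := by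
  rw [orderOf_eq_card_of_forall_mem_zpowers hσ, IsGalois.card_aut_eq_finrank, hdeg]

theorem isHilbertModule_units (hp : p.Prime) (hdeg : Module.finrank F K = p ^ n)
    (hF : ∀ ζ : F, ¬ IsPrimitiveRoot ζ p) {σ : Gal(K/F)} (hσ : ∀ g, g ∈ Subgroup.zpowers σ) :
    letI := unitsModule σ
    IsHilbertModule p n (Additive Kˣ) := by
  let _ := unitsModule σ
  have hord := orderOf_generator hdeg hσ
  refine ⟨fun x hx => ?_, fun x => ?_, fun i hi w hw => ?_⟩
  · rw [Nat.cast_smul_eq_nsmul] at hx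
    have h1 : (x.toMul : K) ^ p = 1 := congrArg Units.val (congrArg Additive.toMul hx)
    exact congrArg Additive.ofMul (Units.ext (eq_one_of_pow_eq_one hp hdeg hF h1))
  · refine (X_pow_sub_one_smul_eq_zero_iff σ _ x.toMul).2 ?_
    rw [← hord, pow_orderOf_eq_one, one_smul]
  · have h1 : orderOf (σ ^ p ^ i) = p ^ (n - i) := by
      rw [orderOf_pow, hord, Nat.gcd_eq_right (pow_dvd_pow p hi), Nat.pow_div hi hp.pos]
    obtain ⟨v, hv⟩ := exists_div_eq_of_prod_eq_one (σ ^ p ^ i) h1 (Nat.pow_pos hp.pos) w.toMul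
      (Additive.ofMul.injective ((sum_X_pow_smul σ (p ^ (n - i)) (p ^ i) w.toMul).symm.trans hw))
    refine ⟨Additive.ofMul v, ?_⟩
    rw [sub_smul, one_smul, X_pow_smul]
    exact congrArg Additive.ofMul hv

variable [IsCyclic Gal(K/F)]

theorem orderOf_restrictNormal (hdeg : Module.finrank F K = p ^ n) {σ : Gal(K/F)}
    (hσ : ∀ g, g ∈ Subgroup.zpowers σ) {i : ℕ} (hi : i ≤ n) :
    orderOf (AlgEquiv.restrictNormalHom (layer F K p i) σ) = p ^ i := by
  have : IsGalois F (layer F K p i) := ⟨⟩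
  exact orderOf_generator ((eq_layer_iff hdeg hi _).1 rfl) (restrictNormal_generator hσ i)

theorem norm_layer (hdeg : Module.finrank F K = p ^ n) {σ : Gal(K/F)}
    (hσ : ∀ g, g ∈ Subgroup.zpowers σ) {i : ℕ} (hi : i ≤ n) (u : (layer F K p i)ˣ) :
    Units.map (algebraMap F K : F →* K) (Units.map (Algebra.norm F : layer F K p i →* F) u) =
      ∏ k ∈ Finset.range (p ^ i), (σ ^ k) • layerUnits F K p i u := by
  have : IsGalois F (layer F K p i) := ⟨⟩
  classical
  ext
  rw [Units.coe_prod]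
  change algebraMap F K (Algebra.norm F (u : layer F K p i)) =
    ∏ k ∈ Finset.range (p ^ i), (σ ^ k) ((u : layer F K p i) : K)
  rw [IsScalarTower.algebraMap_apply F (layer F K p i) K, Algebra.norm_eq_prod_automorphisms,
    ← IsCyclic.image_range_orderOf (restrictNormal_generator hσ i),
    orderOf_restrictNormal hdeg hσ hi, Finset.prod_image, map_prod]
  · refine Finset.prod_congr rfl fun k _ => ?_
    rw [← map_pow]
    exact AlgEquiv.restrictNormal_commutes (σ ^ k) (layer F K p i) u
  · intro k hk l hl h
    have := orderOf_restrictNormal hdeg hσ hi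
    exact pow_injOn_Iio_orderOf (by simpa [this] using hk) (by simpa [this] using hl) h

end Fields

end CyclicModule

/-! ### The norm filtration and the existence of a norm basis -/

namespace CyclicModule

open Polynomial

variable {F : Type u} {K : Type v} [Field F] [Field K] [Algebra F K] {p n : ℕ}

section NormQuotient

variable (F K p n) in
/-- The class of an element of the norm filtration. -/
def normQuotientMk (i : ℕ) : Additive (normFiltration F K p n i) →+ NormQuotient F K p n i :=
  (QuotientGroup.mk'
    ((normFiltration F K p n (i + 1)).subgroupOf (normFiltration F K p n i))).toAdditive

theorem normQuotientMk_surjective (i : ℕ) : Function.Surjective (normQuotientMk F K p n i) :=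
  QuotientGroup.mk'_surjective
    ((normFiltration F K p n (i + 1)).subgroupOf (normFiltration F K p n i))

theorem normQuotientMk_eq_zero_iff {i : ℕ} (x : Additive (normFiltration F K p n i)) :
    normQuotientMk F K p n i x = 0 ↔ (x.toMul : Fˣ) ∈ normFiltration F K p n (i + 1) :=
  (QuotientGroup.eq_one_iff
    (N := (normFiltration F K p n (i + 1)).subgroupOf (normFiltration F K p n i)) x.toMul)

theorem powMonoidHom_range_le (i : ℕ) :
    (powMonoidHom p : Fˣ →* Fˣ).range ≤ normFiltration F K p n i := by
  unfold normFiltration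
  split_ifs
  · exact le_sup_right
  · exact le_rfl

theorem mem_normFiltration_iff {i : ℕ} (hi : i ≤ n) (x : Fˣ) :
    x ∈ normFiltration F K p n i ↔ ∃ (u : (layer F K p i)ˣ) (f : Fˣ),
      x = Units.map (Algebra.norm F : layer F K p i →* F) u * f ^ p := by
  rw [normFiltration, if_pos hi, Subgroup.mem_sup]
  simp [eq_comm]

theorem mem_normFiltration_last_iff (x : Fˣ) :
    x ∈ normFiltration F K p n (n + 1) ↔ ∃ f : Fˣ, x = f ^ p := by
  rw [normFiltration, if_neg (by omega)]
  simp [eq_comm]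

/-- The factor in $F^{\times p}$ lies in every step of the filtration, so it dies in the quotient.
-/
theorem exists_norm_class {i : ℕ} (hi : i ≤ n) (x : NormQuotient F K p n i) :
    ∃ (u : (layer F K p i)ˣ) (y : Additive (normFiltration F K p n i)),
      (y.toMul : Fˣ) = Units.map (Algebra.norm F : layer F K p i →* F) u ∧
      normQuotientMk F K p n i y = x := by
  obtain ⟨x, rfl⟩ := normQuotientMk_surjective i x
  obtain ⟨u, f, h⟩ := (mem_normFiltration_iff hi _).1 x.toMul.2
  have hu : Units.map (Algebra.norm F : layer F K p i →* F) u ∈ normFiltration F K p n i :=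
    (mem_normFiltration_iff hi _).2 ⟨u, 1, by simp⟩
  refine ⟨u, Additive.ofMul ⟨_, hu⟩, rfl, ?_⟩
  rw [← sub_eq_zero, ← map_sub, normQuotientMk_eq_zero_iff]
  apply powMonoidHom_range_le
  refine ⟨f⁻¹, ?_⟩
  change f⁻¹ ^ p = Units.map (Algebra.norm F : layer F K p i →* F) u / (x.toMul : Fˣ)
  rw [h, inv_pow, div_mul_cancel_left]

end NormQuotient

/-- The image in `Kˣ` of the norm filtration, written additively. -/
def unitFiltration (F : Type u) (K : Type v) [Field F] [Field K] [Algebra F K] (p n i : ℕ) :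
    AddSubgroup (Additive Kˣ) :=
  ((normFiltration F K p n i).map (Units.map (algebraMap F K : F →* K))).toAddSubgroup

theorem mem_unitFiltration_iff {i : ℕ} (y : Additive Kˣ) :
    y ∈ unitFiltration F K p n i ↔ ∃ f ∈ normFiltration F K p n i,
      Additive.ofMul (Units.map (algebraMap F K : F →* K) f) = y := Iff.rfl

theorem ofMul_map_mem_unitFiltration_iff {i : ℕ} (f : Fˣ) :
    Additive.ofMul (Units.map (algebraMap F K : F →* K) f) ∈ unitFiltration F K p n i ↔
      f ∈ normFiltration F K p n i := by
  rw [mem_unitFiltration_iff]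
  refine ⟨fun ⟨g, hg, h⟩ => ?_, fun h => ⟨f, h, rfl⟩⟩
  have := Units.map_injective (algebraMap F K).injective (Additive.ofMul.injective h)
  exact this ▸ hg

variable [FiniteDimensional F K] [IsGalois F K]

theorem X_sub_one_smul_eq_zero_iff {σ : Gal(K/F)} (hσ : ∀ g, g ∈ Subgroup.zpowers σ)
    (f : Additive Kˣ) :
    letI := unitsModule σ
    (X - 1 : ℤ[X]) • f = 0 ↔
      ∃ g : Fˣ, f = Additive.ofMul (Units.map (algebraMap F K : F →* K) g) := by
  let _ := unitsModule σ
  have h := X_pow_sub_one_smul_eq_zero_iff σ 1 f.toMul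
  rw [pow_one, pow_one] at h
  refine h.trans ⟨fun hf => ?_, ?_⟩
  · have h1 : (f.toMul : K) ∈ (⊥ : IntermediateField F K) := by
      refine (IsGalois.mem_bot_iff_fixed _).2 ?_
      intro g
      have : Subgroup.zpowers σ ≤ MulAction.stabilizer Gal(K/F) f.toMul := by
        rw [Subgroup.zpowers_le]; exact hf
      exact congrArg Units.val (this (hσ g))
    obtain ⟨x, hx⟩ := IntermediateField.mem_bot.1 h1
    refine ⟨Units.mk0 x ?_, congrArg Additive.ofMul (Units.ext hx.symm)⟩
    rintro rfl
    exact f.toMul.ne_zero (by rw [← hx, map_zero])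
  · rintro ⟨g, rfl⟩
    exact Units.ext (σ.commutes g)

variable [IsCyclic Gal(K/F)]

theorem normPoly_smul_layerUnits (hdeg : Module.finrank F K = p ^ n) {σ : Gal(K/F)}
    (hσ : ∀ g, g ∈ Subgroup.zpowers σ) {i : ℕ} (hi : i ≤ n) (u : (layer F K p i)ˣ) :
    letI := unitsModule σ
    normPoly p i • Additive.ofMul (layerUnits F K p i u) =
      Additive.ofMul (Units.map (algebraMap F K : F →* K)
        (Units.map (Algebra.norm F : layer F K p i →* F) u)) := by
  let _ := unitsModule σ
  rw [norm_layer hdeg hσ hi, normPoly]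
  simpa using sum_X_pow_smul σ (p ^ i) 1 (layerUnits F K p i u)

variable (F K p n) in
theorem exists_isNormBasis [Fact p.Prime] (hdeg : Module.finrank F K = p ^ n) {σ : Gal(K/F)}
    (hσ : ∀ g, g ∈ Subgroup.zpowers σ) :
    letI := unitsModule σ
    ∃ (ι : Fin (n + 1) → Type u) (b : ∀ i : Fin (n + 1), ι i → (layer F K p i)ˣ),
      (∀ i : Fin (n + 1), #(ι i) = normRank F K p n i) ∧
      IsNormBasis p n (unitFiltration F K p n)
        (fun i j => Additive.ofMul (layerUnits F K p i (b i j))) := by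
  let _ := unitsModule σ
  let B (i : Fin (n + 1)) := Module.Basis.ofVectorSpace (ZMod p) (NormQuotient F K p n i)
  choose b y hy hyB using fun (i : Fin (n + 1)) j =>
    exists_norm_class (Nat.lt_succ_iff.1 i.2) (B i j)
  -- Integral combinations of the representatives reduce to $\mathbb F_p$-combinations of the basis;
  -- this yields both `indep` and `span`.
  have hmk (i : Fin (n + 1)) (c : _ →₀ ℤ) :
      normQuotientMk F K p n i (Finsupp.linearCombination ℤ (y i) c) =
        Finsupp.linearCombination (ZMod p) (B i)
          (c.mapRange (Int.castRingHom (ZMod p)) (map_zero _)) := by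
    induction c using Finsupp.induction_linear with
    | zero => simp
    | add c d hc hd =>
      rw [map_add, map_add, hc, hd, Finsupp.mapRange_add (map_add _), map_add]
    | single j r => simp [hyB, Int.cast_smul_eq_zsmul]
  have hlc (i : Fin (n + 1)) (c : _ →₀ ℤ) :
      Finsupp.linearCombination ℤ
        (fun j => normPoly p i • Additive.ofMul (layerUnits F K p i (b i j))) c =
      Additive.ofMul (Units.map (algebraMap F K : F →* K)
        ((Finsupp.linearCombination ℤ (y i) c).toMul : normFiltration F K p n i)) := by
    let φ : Additive (normFiltration F K p n i) →+ Additive Kˣ :=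
      ((Units.map (algebraMap F K : F →* K)).comp
        (normFiltration F K p n i).subtype).toAdditive
    change _ = φ.toIntLinearMap _
    rw [← LinearMap.comp_apply]
    congr 1
    ext j
    simp only [LinearMap.comp_apply, Finsupp.lsingle_apply, Finsupp.linearCombination_single,
      one_smul]
    rw [normPoly_smul_layerUnits hdeg hσ (by omega), ← hy i j]
    rfl
  refine ⟨fun i => Module.Basis.ofVectorSpaceIndex (ZMod p) (NormQuotient F K p n i), b,
    fun i => (B i).mk_eq_rank'', ?_⟩
  constructor
  · intro i hi y
    rw [mem_unitFiltration_iff]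
    constructor
    · rintro ⟨f, hf, rfl⟩
      obtain ⟨u, g, rfl⟩ := (mem_normFiltration_iff hi _).1 hf
      refine ⟨Additive.ofMul (layerUnits F K p i u),
        Additive.ofMul (Units.map (algebraMap F K : F →* K) g),
        (X_pow_sub_one_smul_eq_zero_iff _ _ _).2 ((exists_layerUnits_eq_iff hσ i _).1 ⟨u, rfl⟩),
        (X_sub_one_smul_eq_zero_iff hσ _).2 ⟨g, rfl⟩, ?_⟩
      rw [normPoly_smul_layerUnits hdeg hσ hi, Nat.cast_smul_eq_nsmul, map_mul, map_pow]
      rfl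
    · rintro ⟨u, f, hu, hf, rfl⟩
      obtain ⟨u', hu'⟩ := (exists_layerUnits_eq_iff hσ i u.toMul).2
        ((X_pow_sub_one_smul_eq_zero_iff _ _ _).1 hu)
      obtain ⟨g, rfl⟩ := (X_sub_one_smul_eq_zero_iff hσ _).1 hf
      refine ⟨_, (mem_normFiltration_iff hi _).2 ⟨u', g, rfl⟩, ?_⟩
      rw [← ofMul_toMul u, ← hu', normPoly_smul_layerUnits hdeg hσ hi, Nat.cast_smul_eq_nsmul,
        map_mul, map_pow]
      rfl
  · intro y
    rw [mem_unitFiltration_iff]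
    constructor
    · rintro ⟨f, hf, rfl⟩
      obtain ⟨g, rfl⟩ := (mem_normFiltration_last_iff _).1 hf
      refine ⟨_, (X_sub_one_smul_eq_zero_iff hσ _).2 ⟨g, rfl⟩, ?_⟩
      rw [Nat.cast_smul_eq_nsmul, map_pow]
      rfl
    · rintro ⟨f, hf, rfl⟩
      obtain ⟨g, rfl⟩ := (X_sub_one_smul_eq_zero_iff hσ _).1 hf
      refine ⟨_, (mem_normFiltration_last_iff _).2 ⟨g, rfl⟩, ?_⟩
      rw [Nat.cast_smul_eq_nsmul, map_pow]
      rfl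
  · intro i j
    exact (X_pow_sub_one_smul_eq_zero_iff _ _ _).2
      ((exists_layerUnits_eq_iff hσ i _).1 ⟨b i j, rfl⟩)
  · intro i c hc j
    rw [hlc, ofMul_map_mem_unitFiltration_iff, ← normQuotientMk_eq_zero_iff, hmk] at hc
    have := DFunLike.congr_fun (linearIndependent_iff.1 (B i).linearIndependent _ hc) j
    simpa [ZMod.intCast_zmod_eq_zero_iff_dvd] using this
  · intro i w hw
    obtain ⟨f, hf, rfl⟩ := (mem_unitFiltration_iff _).1 hw
    obtain ⟨c, hc⟩ := Finsupp.mapRange_surjective (Int.castRingHom (ZMod p)) (map_zero _)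
      (ZMod.intCast_surjective) ((B i).repr (normQuotientMk F K p n i (Additive.ofMul ⟨f, hf⟩)))
    have h1 := hmk i c
    rw [hc, (B i).linearCombination_repr] at h1
    refine ⟨c, ?_⟩
    have h2 := (normQuotientMk_eq_zero_iff _).1
      ((map_sub (normQuotientMk F K p n i) _ _).trans (sub_eq_zero.2 h1.symm))
    rw [hlc, ← ofMul_div, ← _root_.map_div, ofMul_map_mem_unitFiltration_iff]
    exact h2

end CyclicModule

/-! ### Change of coefficients for free modules -/

/-- A surjection with kernel `qV` onto a `ℤ/q`-module identifies its target with `V / qV`. -/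
theorem ModN.exists_linearEquiv {V W : Type*} [AddCommGroup V] [AddCommGroup W] (q : ℕ)
    [Module (ZMod q) W] (f : V →+ W) (hf : Function.Surjective f)
    (hker : ∀ x, f x = 0 ↔ ∃ y, x = q • y) :
    ∃ e : ModN V q ≃ₗ[ZMod q] W, ∀ x, e (ModN.mkQ q x) = f x := by
  let g : ModN V q →ₗ[ℤ] W := Submodule.liftQ _ f.toIntLinearMap (by
    rintro _ ⟨y, rfl⟩
    exact (hker _).2 ⟨y, by simp⟩)
  let g' : ModN V q →ₗ[ZMod q] W := g.toAddMonoidHom.toZModLinearMap q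
  have hg (x : V) : g' (ModN.mkQ q x) = f x := rfl
  refine ⟨LinearEquiv.ofBijective g' ⟨?_, fun w => ?_⟩, hg⟩
  · rw [injective_iff_map_eq_zero]
    intro x hx
    obtain ⟨x, rfl⟩ := Submodule.Quotient.mk_surjective _ x
    obtain ⟨y, rfl⟩ := (hker x).1 hx
    exact (Submodule.Quotient.mk_eq_zero _).2 ⟨y, by simp⟩
  · obtain ⟨x, rfl⟩ := hf w
    exact ⟨_, hg x⟩

namespace Representation

open MonoidAlgebra

/-- Freeness is invariant under isomorphism. -/
theorem IsFreeOfRank.of_equiv {k G V W : Type*} [CommRing k] [Group G] [AddCommGroup V]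
    [Module k V] [AddCommGroup W] [Module k W] {ρ : Representation k G V}
    {σ : Representation k G W} {κ : Cardinal.{u}} (h : σ.IsFreeOfRank κ) (e : ρ.Equiv σ) :
    ρ.IsFreeOfRank κ := by
  obtain ⟨ι, hι, ⟨B⟩⟩ := h
  let f := IntertwiningMap.equivLinearMapAsModule σ ρ e.symm.toIntertwiningMap
  have hf : Function.Bijective f := e.symm.toLinearEquiv.bijective
  exact ⟨ι, hι, ⟨B.map (LinearEquiv.ofBijective f hf)⟩⟩

theorem isFreeOfRank_free (k G : Type*) [CommRing k] [Group G] (ι : Type u) :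
    (free k G ι).IsFreeOfRank #ι :=
  ⟨ι, rfl, ⟨freeAsModuleBasis k G ι⟩⟩

section Reduction

variable {k k' k'' : Type*} [CommRing k] [CommRing k'] [CommRing k''] (G : Type*) [Group G]
  (ι : Type*)

/-- Change of coefficients on free representations. -/
def freeMap (φ : k →+* k') : (ι →₀ k[G]) →ₛₗ[φ] (ι →₀ k'[G]) where
  toFun := Finsupp.mapRange (mapRingHom G φ) (map_zero _)
  map_add' := Finsupp.mapRange_add (map_add _)
  map_smul' r x := by ext; simp

variable {G ι}

theorem freeMap_coeff (φ : k →+* k') (x : ι →₀ k[G]) (i : ι) (g : G) :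
    (freeMap G ι φ x i).coeff g = φ ((x i).coeff g) := by
  simp [freeMap]

theorem nsmul_coeff (q : ℕ) (x : ι →₀ k[G]) (i : ι) (g : G) :
    ((q • x) i).coeff g = q * (x i).coeff g := by
  rw [Finsupp.smul_apply, ← Nat.cast_smul_eq_nsmul k, coeff_smul, Finsupp.smul_apply, smul_eq_mul]

theorem freeMap_surjective {φ : k →+* k'} (hφ : Function.Surjective φ) :
    Function.Surjective (freeMap G ι φ) := by
  refine Finsupp.mapRange_surjective _ (map_zero _) fun y => ?_
  obtain ⟨x, hx⟩ := Finsupp.mapRange_surjective φ (map_zero _) hφ y.coeff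
  exact ⟨ofCoeff x, by ext g; simp [← hx]⟩

theorem freeMap_eq_zero_iff {φ : k →+* k'} {q : ℕ} (hφ : ∀ r, φ r = 0 ↔ (q : k) ∣ r)
    (x : ι →₀ k[G]) : freeMap G ι φ x = 0 ↔ ∃ y, x = q • y := by
  constructor
  · intro hx
    have h (i : ι) (g : G) : ∃ c : k, (x i).coeff g = q * c :=
      (hφ _).1 (by rw [← freeMap_coeff, hx]; rfl)
    choose c hc using h
    classical
    refine ⟨Finsupp.onFinset x.support (fun i => ofCoeff (Finsupp.onFinset (x i).coeff.support
      (fun g => if (x i).coeff g = 0 then 0 else c i g) (by simp_all)))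
      (fun i hi => ?_), ?_⟩
    · rw [Finsupp.mem_support_iff]
      intro h0
      apply hi
      ext g
      simp [h0]
    · ext i g
      rw [nsmul_coeff]
      by_cases h0 : (x i).coeff g = 0
      · simp [h0]
      · simpa [h0] using hc i g
  · rintro ⟨y, rfl⟩
    ext i g
    rw [freeMap_coeff, nsmul_coeff, map_mul, (hφ q).2 dvd_rfl]
    simp

theorem freeMap_freeMap (φ : k →+* k') (ψ : k' →+* k'') (x : ι →₀ k[G]) :
    freeMap G ι ψ (freeMap G ι φ x) = freeMap G ι (ψ.comp φ) x := by
  ext i g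
  simp [freeMap_coeff]

theorem freeMap_apply (φ : k →+* k') (g : G) (x : ι →₀ k[G]) :
    freeMap G ι φ (free k G ι g x) = free k' G ι g (freeMap G ι φ x) := by
  induction x using Finsupp.induction_linear with
  | zero => simp
  | add x y hx hy => simp [hx, hy]
  | single i a =>
    induction a using MonoidAlgebra.induction_linear with
    | zero => simp
    | add x y hx hy => simp only [Finsupp.single_add, map_add, hx, hy]
    | single h r => simp [freeMap]

end Reduction

end Representation

/-! ### Completions of free $\mathbb Z_p[G]$-modules -/

namespace Representation

open MonoidAlgebra

variable (p : ℕ) [hp : Fact p.Prime] (G : Type*) [Group G] (ι : Type*)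

/-- The completion of a free `ℤ_p[G]`-module. -/
abbrev FreeCompletion : Type _ :=
  AdicCompletion (Ideal.span {(p : ℤ_[p])}) (ι →₀ MonoidAlgebra ℤ_[p] G)

/-- The action of `G` on the completion of a free `ℤ_p[G]`-module. -/
abbrev freeCompletion : Representation ℤ_[p] G (FreeCompletion p G ι) :=
  (free ℤ_[p] G ι).adicCompletion (Ideal.span {(p : ℤ_[p])})

theorem toZModPow_eq_zero_iff (m : ℕ) (r : ℤ_[p]) :
    PadicInt.toZModPow m r = 0 ↔ ((p ^ m : ℕ) : ℤ_[p]) ∣ r := by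
  rw [← RingHom.mem_ker, PadicInt.ker_toZModPow, Ideal.mem_span_singleton, Nat.cast_pow]

variable {p} in
theorem mem_span_pow_smul_top_iff {V : Type*} [AddCommGroup V] [Module ℤ_[p] V] (m : ℕ) (x : V) :
    x ∈ (Ideal.span {(p : ℤ_[p])} ^ m • ⊤ : Submodule ℤ_[p] V) ↔ ∃ y, x = p ^ m • y := by
  rw [Ideal.span_singleton_pow, Submodule.ideal_span_singleton_smul,
    Submodule.mem_smul_pointwise_iff_exists]
  simp only [Submodule.mem_top, true_and, ← Nat.cast_smul_eq_nsmul ℤ_[p], Nat.cast_pow, eq_comm]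

/-- Reduction modulo `p ^ m` of the completion of a free module. -/
def completionMap (m : ℕ) :
    FreeCompletion p G ι →ₛₗ[PadicInt.toZModPow (p := p) m] (ι →₀ MonoidAlgebra (ZMod (p ^ m)) G) :=
  (Submodule.liftQ _ (freeMap G ι (PadicInt.toZModPow m)) fun x hx => by
    rw [LinearMap.mem_ker, freeMap_eq_zero_iff (toZModPow_eq_zero_iff p m)]
    exact (mem_span_pow_smul_top_iff m x).1 hx).comp
    (AdicCompletion.eval (Ideal.span {(p : ℤ_[p])}) _ m)

variable {p G ι}

theorem completionMap_of_eval_eq {m : ℕ} {x : FreeCompletion p G ι}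
    {a : ι →₀ MonoidAlgebra ℤ_[p] G} (h : x.val m = Submodule.Quotient.mk a) :
    completionMap p G ι m x = freeMap G ι (PadicInt.toZModPow m) a := by
  simp [completionMap, h]

theorem exists_val_eq_mk (m : ℕ) (x : FreeCompletion p G ι) :
    ∃ a, x.val m = Submodule.Quotient.mk a :=
  (Submodule.Quotient.mk_surjective _ (x.val m)).imp fun _ h => h.symm

theorem completionMap_of (m : ℕ) (a : ι →₀ MonoidAlgebra ℤ_[p] G) :
    completionMap p G ι m (AdicCompletion.of _ _ a) = freeMap G ι (PadicInt.toZModPow m) a :=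
  completionMap_of_eval_eq rfl

theorem completionMap_eq_zero_iff_val (m : ℕ) (x : FreeCompletion p G ι) :
    completionMap p G ι m x = 0 ↔ x.val m = 0 := by
  obtain ⟨a, ha⟩ := exists_val_eq_mk m x
  rw [completionMap_of_eval_eq ha, ha, Submodule.Quotient.mk_eq_zero, mem_span_pow_smul_top_iff,
    freeMap_eq_zero_iff (toZModPow_eq_zero_iff p m)]

theorem completionMap_eq_zero_iff (m : ℕ) (x : FreeCompletion p G ι) :
    completionMap p G ι m x = 0 ↔ ∃ y, x = p ^ m • y := by
  -- The kernel of evaluation at level $m$ is $p^m$ times the completion because the ideal $(p)$ is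
  -- finitely generated.
  rw [completionMap_eq_zero_iff_val, ← mem_span_pow_smul_top_iff,
    AdicCompletion.pow_smul_top_eq_ker_eval (Submodule.fg_span_singleton _)]
  rfl

theorem completionMap_surjective (m : ℕ) : Function.Surjective (completionMap p G ι m) := by
  intro y
  obtain ⟨a, rfl⟩ := freeMap_surjective (ZMod.ringHom_surjective (PadicInt.toZModPow (p := p) m)) y
  exact ⟨_, completionMap_of m a⟩

theorem ext_completionMap {x y : FreeCompletion p G ι}
    (h : ∀ m, completionMap p G ι m x = completionMap p G ι m y) : x = y := by
  refine sub_eq_zero.1 (AdicCompletion.ext fun m => ?_)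
  refine (completionMap_eq_zero_iff_val m _).1 ?_
  rw [map_sub, h, sub_self]

theorem completionMap_apply (m : ℕ) (g : G) (x : FreeCompletion p G ι) :
    completionMap p G ι m (freeCompletion p G ι g x) =
      free (ZMod (p ^ m)) G ι g (completionMap p G ι m x) := by
  obtain ⟨a, ha⟩ := exists_val_eq_mk m x
  rw [completionMap_of_eval_eq ha, ← freeMap_apply]
  refine completionMap_of_eval_eq ?_
  change (AdicCompletion.map _ (free ℤ_[p] G ι g) x).val m = _
  rw [AdicCompletion.map_val_apply, ha]
  rfl

/-- The reduction `ℤ/p^(m+1) → ℤ/p^m`. -/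
abbrev zmodPowCast (p m : ℕ) : ZMod (p ^ (m + 1)) →+* ZMod (p ^ m) :=
  ZMod.castHom (pow_dvd_pow p m.le_succ) _

theorem freeMap_completionMap (m : ℕ) (x : FreeCompletion p G ι) :
    freeMap G ι (zmodPowCast p m) (completionMap p G ι (m + 1) x) = completionMap p G ι m x := by
  obtain ⟨a, ha⟩ := exists_val_eq_mk (m + 1) x
  rw [completionMap_of_eval_eq ha, freeMap_freeMap, PadicInt.zmod_cast_comp_toZModPow _ _ m.le_succ]
  refine (completionMap_of_eval_eq ?_).symm
  rw [← AdicCompletion.transitionMap_comp_eval_apply _ _ m.le_succ, ha]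
  rfl

/-- Lifts to $\mathbb Z_p$ chosen separately at each level form an adic Cauchy sequence. With
`ext_completionMap`, the completion is the limit of the free modules over $\mathbb Z/p^m$. -/
theorem exists_completionMap_eq (z : ∀ m, ι →₀ MonoidAlgebra (ZMod (p ^ m)) G)
    (hz : ∀ m, freeMap G ι (zmodPowCast p m) (z (m + 1)) = z m) :
    ∃ x, ∀ m, completionMap p G ι m x = z m := by
  choose a ha using fun m => freeMap_surjective (G := G) (ι := ι)
    (ZMod.ringHom_surjective (PadicInt.toZModPow (p := p) m)) (z m)
  refine ⟨AdicCompletion.mk _ _ (AdicCompletion.AdicCauchySequence.mk _ _ a fun m => ?_),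
    fun m => ?_⟩
  · rw [SModEq.sub_mem, mem_span_pow_smul_top_iff,
      ← freeMap_eq_zero_iff (toZModPow_eq_zero_iff p m), map_sub, ha,
      ← PadicInt.zmod_cast_comp_toZModPow _ _ m.le_succ, ← freeMap_freeMap, ha, hz, sub_self]
  · rw [← ha]
    exact completionMap_of_eval_eq rfl

variable (p G ι) in
theorem exists_modN_freeCompletion_equiv (m : ℕ) :
    ∃ e : ((freeCompletion p G ι).modN (p ^ m)).Equiv (free (ZMod (p ^ m)) G ι),
      ∀ x, e (ModN.mkQ (p ^ m) x) = completionMap p G ι m x := by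
  obtain ⟨e, he⟩ := ModN.exists_linearEquiv (p ^ m) (completionMap p G ι m).toAddMonoidHom
    (completionMap_surjective m) (completionMap_eq_zero_iff m)
  refine ⟨.mk e fun g => LinearMap.ext fun x => ?_, he⟩
  obtain ⟨x, rfl⟩ := Submodule.Quotient.mk_surjective _ x
  exact (he _).trans ((completionMap_apply m g x).trans (congrArg _ (he x).symm))

theorem exists_toZModPow_eq (f : ℕ → ℤ_[p])
    (hf : ∀ m, PadicInt.toZModPow m (f (m + 1)) = PadicInt.toZModPow m (f m)) :
    ∃ L, ∀ m, PadicInt.toZModPow m L = PadicInt.toZModPow m (f m) := by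
  have key (m : ℕ) (x y : ℤ_[p]) : PadicInt.toZModPow m x = PadicInt.toZModPow m y ↔
      x ≡ y [SMOD (IsLocalRing.maximalIdeal ℤ_[p] ^ m • ⊤ : Submodule ℤ_[p] ℤ_[p])] := by
    rw [SModEq.sub_mem, ← sub_eq_zero, ← map_sub, ← RingHom.mem_ker, PadicInt.ker_toZModPow,
      PadicInt.maximalIdeal_eq_span_p, Ideal.span_singleton_pow, smul_eq_mul, Ideal.mul_top]
  obtain ⟨L, hL⟩ := IsPrecomplete.prec (I := IsLocalRing.maximalIdeal ℤ_[p]) inferInstance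
    (f := f) fun {m n} hmn => (key m _ _).1 (by
      induction n, hmn using Nat.le_induction with
      | base => rfl
      | succ n hmn ih =>
        rw [ih, ← PadicInt.cast_toZModPow m n hmn, ← hf, PadicInt.cast_toZModPow m n hmn])
  exact ⟨L, fun m => ((key m _ _).2 (hL m)).symm⟩

/-- With finitely many coordinates, separatedness and completeness of $\mathbb Z_p$ apply to each,
and finite support is automatic. -/
theorem of_bijective_of_finite [Finite G] [Finite ι] :
    Function.Bijective
      (AdicCompletion.of (Ideal.span {(p : ℤ_[p])}) (ι →₀ MonoidAlgebra ℤ_[p] G)) := by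
  constructor
  · rw [injective_iff_map_eq_zero]
    intro a ha
    ext i g
    refine PadicInt.ext_of_toZModPow.1 fun m => ?_
    rw [← freeMap_coeff, ← completionMap_of, ha]
    simp
  · intro y
    choose a ha using fun m => freeMap_surjective (G := G) (ι := ι)
      (ZMod.ringHom_surjective (PadicInt.toZModPow (p := p) m)) (completionMap p G ι m y)
    have hc (i : ι) (g : G) : ∃ L : ℤ_[p], ∀ m,
        PadicInt.toZModPow m L = PadicInt.toZModPow m ((a m i).coeff g) := by
      refine exists_toZModPow_eq _ fun m => ?_
      rw [← freeMap_coeff, ← freeMap_coeff, ha, ← freeMap_completionMap, ← ha, freeMap_freeMap,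
        PadicInt.zmod_cast_comp_toZModPow _ _ m.le_succ]
    choose L hL using hc
    refine ⟨Finsupp.equivFunOnFinite.symm fun i => ofCoeff (Finsupp.equivFunOnFinite.symm (L i)),
      ext_completionMap fun m => ?_⟩
    rw [completionMap_of, ← ha]
    ext i g
    rw [freeMap_coeff, freeMap_coeff, ← hL]
    rfl

theorem isFreeOfRank_freeCompletion [Finite G] {ι : Type u} [Finite ι] :
    (freeCompletion p G ι).IsFreeOfRank #ι := by
  refine (isFreeOfRank_free ℤ_[p] G ι).of_equiv (Equiv.symm (.mk
    (LinearEquiv.ofBijective _ of_bijective_of_finite) fun g => LinearMap.ext fun x => ?_))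
  refine ext_completionMap fun m => ?_
  change completionMap p G ι m (AdicCompletion.of _ _ (free ℤ_[p] G ι g x)) =
    completionMap p G ι m (freeCompletion p G ι g (AdicCompletion.of _ _ x))
  rw [completionMap_apply, completionMap_of, completionMap_of, freeMap_apply]

end Representation

/-! ### The map from free modules over the layers to $K^\times$ -/

namespace CyclicModule

open Representation

/-- A homomorphism into a group without `p`-torsion that is bijective modulo `p` is bijective modulo
every power of `p`. -/
theorem bijective_mod_pow {V M : Type*} [AddCommGroup V] [AddCommGroup M] {p : ℕ} (Φ : V →+ M)
    (htf : ∀ x : M, p • x = 0 → x = 0) (hinj : ∀ a y, Φ a = p • y → ∃ a', a = p • a')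
    (hsurj : ∀ y, ∃ a z, y = Φ a + p • z) (m : ℕ) :
    (∀ a y, Φ a = p ^ m • y → ∃ a', a = p ^ m • a') ∧ ∀ y, ∃ a z, y = Φ a + p ^ m • z := by
  induction m with
  | zero => exact ⟨fun a y _ => ⟨a, by simp⟩, fun y => ⟨0, y, by simp⟩⟩
  | succ m ih =>
    refine ⟨fun a y h => ?_, fun y => ?_⟩
    · rw [pow_succ', mul_smul] at h
      obtain ⟨a', rfl⟩ := hinj _ _ h
      rw [map_nsmul] at h
      have h' : Φ a' = p ^ m • y := sub_eq_zero.1 (htf _ (by rw [smul_sub, h, sub_self]))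
      obtain ⟨a'', rfl⟩ := ih.1 _ _ h'
      exact ⟨a'', by rw [pow_succ', mul_smul]⟩
    · obtain ⟨a, z, rfl⟩ := ih.2 y
      obtain ⟨a', z', rfl⟩ := hsurj z
      exact ⟨a + p ^ m • a', z', by
        rw [map_add, map_nsmul, pow_succ, mul_smul, smul_add, add_assoc]⟩

variable {F : Type u} {K : Type v} [Field F] [Field K] [Algebra F K] {p n : ℕ}

/-- The action of the Galois group on the units of a field. -/
abbrev unitsAction (F E : Type*) [Field F] [Field E] [Algebra F E] :
    MulDistribMulAction Gal(E/F) Eˣ := inferInstance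

instance layerUnitsSMul (i : ℕ) : SMul Gal(layer F K p i/F) (layer F K p i)ˣ :=
  (unitsAction F (layer F K p i)).toSMul

section LayerMap

open Polynomial

variable {i : ℕ} {ι : Type*} (b : ι → (layer F K p i)ˣ)

/-- The homomorphism from a free module over `ℤ[Gal(K_i/F)]` to `Kˣ` given by elements of the
`i`-th layer. -/
def layerMap : (ι →₀ MonoidAlgebra ℤ Gal(layer F K p i/F)) →ₗ[ℤ] Additive Kˣ :=
  (MonoidHom.toAdditive (layerUnits F K p i)).toIntLinearMap ∘ₗ
    (freeLift (ofMulDistribMulAction Gal(layer F K p i/F) (layer F K p i)ˣ)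
      fun j => Additive.ofMul (b j)).toLinearMap

theorem layerMap_single (j : ι) (g : Gal(layer F K p i/F)) (r : ℤ) :
    layerMap b (Finsupp.single j (.single g r)) =
      r • Additive.ofMul (layerUnits F K p i (g • b j)) := by
  simp only [layerMap, LinearMap.comp_apply, IntertwiningMap.toLinearMap_apply,
    freeLift_single_single, map_smul]
  rfl

variable [IsGalois F K] [IsCyclic Gal(K/F)]

theorem layerUnits_smul (g : Gal(K/F)) (u : (layer F K p i)ˣ) :
    layerUnits F K p i (AlgEquiv.restrictNormalHom (layer F K p i) g • u) =
      g • layerUnits F K p i u :=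
  Units.ext (AlgEquiv.restrictNormal_commutes g (layer F K p i) u)

theorem layerMap_apply (g : Gal(K/F)) (x : ι →₀ MonoidAlgebra ℤ Gal(layer F K p i/F)) :
    layerMap b (inflate (free ℤ Gal(layer F K p i/F) ι) g x) =
      ofMulDistribMulAction Gal(K/F) Kˣ g (layerMap b x) := by
  change layerMap b (free ℤ _ ι (AlgEquiv.restrictNormalHom (layer F K p i) g) x) = _
  simp only [layerMap, LinearMap.comp_apply, IntertwiningMap.toLinearMap_apply,
    IntertwiningMap.isIntertwining]
  exact congrArg Additive.ofMul (layerUnits_smul g _)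

/-- Translates $\mathbb Z[X]$-combinations of the $b_j$ into values of `layerMap`, through
$X\mapsto\sigma|_{K_i}$. -/
theorem layerMap_mapRange (σ : Gal(K/F)) (f : ι →₀ ℤ[X]) :
    letI := unitsModule σ
    layerMap b (f.mapRange (aeval (MonoidAlgebra.single
      (AlgEquiv.restrictNormalHom (layer F K p i) σ) (1 : ℤ))) (map_zero _)) =
      Finsupp.linearCombination ℤ[X] (fun j => Additive.ofMul (layerUnits F K p i (b j))) f := by
  let _ := unitsModule σ
  induction f using Finsupp.induction_linear with
  | zero => simp
  | add f g hf hg => rw [Finsupp.mapRange_add (map_add _), map_add, map_add, hf, hg]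
  | single j f =>
    induction f using Polynomial.induction_on' with
    | add f g hf hg =>
      rw [Finsupp.single_add, Finsupp.mapRange_add (map_add _), map_add, map_add, hf, hg]
    | monomial k r =>
      rw [Finsupp.mapRange_single, Finsupp.linearCombination_single, aeval_monomial,
        ← C_mul_X_pow_eq_monomial, mul_smul, X_pow_smul, MonoidAlgebra.single_pow, one_pow,
        ← Algebra.smul_def, MonoidAlgebra.smul_single, smul_eq_mul, mul_one, layerMap_single,
        ← map_pow, layerUnits_smul]
      have hC (z : Additive Kˣ) : (C r : ℤ[X]) • z = r • z := by simp [Int.cast_smul_eq_zsmul]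
      exact (hC _).symm

end LayerMap

variable {ι : Fin (n + 1) → Type u} (b : ∀ i : Fin (n + 1), ι i → (layer F K p i)ˣ)

/-- The homomorphism to `Kˣ` given by families of elements of all the layers. -/
def layersMap : (∀ i : Fin (n + 1), ι i →₀ MonoidAlgebra ℤ Gal(layer F K p i/F)) →+ Additive Kˣ :=
  ∑ i, (layerMap (b i)).toAddMonoidHom.comp (Pi.evalAddMonoidHom _ i)

theorem layersMap_apply (a : ∀ i : Fin (n + 1), ι i →₀ MonoidAlgebra ℤ Gal(layer F K p i/F)) :
    layersMap b a = ∑ i, layerMap (b i) (a i) := by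
  simp [layersMap]

variable [FiniteDimensional F K] [IsGalois F K] [IsCyclic Gal(K/F)]

section

open Polynomial

variable {b}

theorem aeval_generator_surjective {σ : Gal(K/F)} (hσ : ∀ g, g ∈ Subgroup.zpowers σ) (i : ℕ) :
    Function.Surjective (aeval (R := ℤ) (MonoidAlgebra.single
      (AlgEquiv.restrictNormalHom (layer F K p i) σ) (1 : ℤ))) := by
  intro a
  induction a using MonoidAlgebra.induction_linear with
  | zero => exact ⟨0, map_zero _⟩
  | add a a' h h' =>
    obtain ⟨f, rfl⟩ := h
    obtain ⟨f', rfl⟩ := h'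
    exact ⟨f + f', map_add _ _ _⟩
  | single g r =>
    obtain ⟨k, rfl⟩ := mem_powers_iff_mem_zpowers.2 (restrictNormal_generator hσ i g)
    refine ⟨C r * X ^ k, ?_⟩
    rw [map_mul, aeval_C, map_pow, aeval_X, ← Algebra.smul_def, MonoidAlgebra.single_pow,
      MonoidAlgebra.smul_single]
    simp

theorem exists_eq_nsmul_of_layersMap_eq [hp : Fact p.Prime] (hdeg : Module.finrank F K = p ^ n)
    (hF : ∀ ζ : F, ¬ IsPrimitiveRoot ζ p) {σ : Gal(K/F)} (hσ : ∀ g, g ∈ Subgroup.zpowers σ)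
    (hb : letI := unitsModule σ
      IsNormBasis p n (unitFiltration F K p n)
        (fun i j => Additive.ofMul (layerUnits F K p i (b i j))))
    (a : ∀ i : Fin (n + 1), ι i →₀ MonoidAlgebra ℤ Gal(layer F K p i/F)) (y : Additive Kˣ)
    (h : layersMap b a = p • y) : ∃ a', a = p • a' := by
  let _ := unitsModule σ
  have hM := isHilbertModule_units hp.out hdeg hF hσ
  choose f hf using fun i : Fin (n + 1) => Finsupp.mapRange_surjective _ (map_zero _)
    (aeval_generator_surjective (p := p) hσ i) (a i)
  have h1 (i : Fin (n + 1)) (j : ι i) := hb.exists_eq_add_of_sum_mem hp.out hM f (by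
    rw [layersMap_apply] at h
    refine mem_multiples.2 ⟨y, ?_⟩
    rw [Nat.cast_smul_eq_nsmul, ← h]
    refine Finset.sum_congr rfl fun i _ => ?_
    rw [← hf, layerMap_mapRange]) i j
  have h2 (i : Fin (n + 1)) : ∃ a', a i = p • a' := by
    refine (freeMap_eq_zero_iff (φ := Int.castRingHom (ZMod p)) (fun r => ?_) _).1 ?_
    · simp [ZMod.intCast_zmod_eq_zero_iff_dvd]
    · ext j g
      obtain ⟨s, t, hst⟩ := h1 i j
      have h3 : a i j = p * aeval (MonoidAlgebra.single
          (AlgEquiv.restrictNormalHom (layer F K p i) σ) (1 : ℤ)) t := by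
        rw [← hf, Finsupp.mapRange_apply, hst]
        -- The term $(X^{p^i}-1)s$ vanishes in $\mathbb Z[G_i]$, leaving a multiple of $p$.
        have : AlgEquiv.restrictNormalHom (layer F K p i) σ ^ p ^ (i : ℕ) = 1 := by
          rw [← orderOf_restrictNormal hdeg hσ (Nat.lt_succ_iff.1 i.2), pow_orderOf_eq_one]
        simp [MonoidAlgebra.single_pow, this, MonoidAlgebra.one_def]
      rw [freeMap_coeff, h3, ← nsmul_eq_mul, ← Nat.cast_smul_eq_nsmul ℤ, MonoidAlgebra.coeff_smul,
        Finsupp.smul_apply, smul_eq_mul, map_mul]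
      simp
  choose a' ha' using h2
  exact ⟨a', funext ha'⟩

theorem exists_eq_layersMap_add [hp : Fact p.Prime] (hdeg : Module.finrank F K = p ^ n)
    (hF : ∀ ζ : F, ¬ IsPrimitiveRoot ζ p) {σ : Gal(K/F)} (hσ : ∀ g, g ∈ Subgroup.zpowers σ)
    (hb : letI := unitsModule σ
      IsNormBasis p n (unitFiltration F K p n)
        (fun i j => Additive.ofMul (layerUnits F K p i (b i j)))) (y : Additive Kˣ) :
    ∃ a z, y = layersMap b a + p • z := by
  let _ := unitsModule σ
  have hM := isHilbertModule_units hp.out hdeg hF hσ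
  obtain ⟨s, hs, t, ht, rfl⟩ := Submodule.mem_sup.1 (hb.mem_span_sup hp.out hM y)
  obtain ⟨z, rfl⟩ := mem_multiples.1 ht
  suffices h : ∃ a, s = layersMap b a by
    obtain ⟨a, rfl⟩ := h
    exact ⟨a, z, by rw [Nat.cast_smul_eq_nsmul]⟩
  clear ht
  rw [Submodule.span_iUnion] at hs
  induction hs using Submodule.iSup_induction' with
  | mem i x hx =>
    rw [← Finsupp.range_linearCombination] at hx
    obtain ⟨f, rfl⟩ := hx
    refine ⟨Pi.single i (f.mapRange (aeval (MonoidAlgebra.single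
      (AlgEquiv.restrictNormalHom (layer F K p i) σ) (1 : ℤ))) (map_zero _)), ?_⟩
    rw [layersMap_apply, Finset.sum_eq_single i, Pi.single_eq_same, layerMap_mapRange]
    · intro k _ hk
      rw [Pi.single_eq_of_ne hk, map_zero]
    · simp
  | zero => exact ⟨0, (map_zero _).symm⟩
  | add x y _ _ hx hy =>
    obtain ⟨a, rfl⟩ := hx
    obtain ⟨a', rfl⟩ := hy
    exact ⟨a + a', (map_add _ _ _).symm⟩

end

end CyclicModule

/-! ### Identification of $J_m$ and $J_\infty$ -/

namespace CyclicModule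

open Representation

variable {F : Type u} {K : Type v} [Field F] [Field K] [Algebra F K] {p n : ℕ}
  {ι : Fin (n + 1) → Type u}

/-- Reduction of coefficients on a product of free modules over the group rings of the layers. -/
def layersReduction (F : Type u) (K : Type v) [Field F] [Field K] [Algebra F K] (p : ℕ) {n : ℕ}
    (ι : Fin (n + 1) → Type u) (q : ℕ) :
    (∀ i : Fin (n + 1), ι i →₀ MonoidAlgebra ℤ Gal(layer F K p i/F)) →+
      (∀ i : Fin (n + 1), ι i →₀ MonoidAlgebra (ZMod q) Gal(layer F K p i/F)) :=
  AddMonoidHom.mk' (fun a i => freeMap Gal(layer F K p i/F) (ι i) (Int.castRingHom (ZMod q)) (a i))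
    fun _ _ => funext fun _ => map_add _ _ _

theorem layersReduction_surjective (q : ℕ) :
    Function.Surjective (layersReduction F K p ι q) := by
  intro z
  choose a ha using fun i => freeMap_surjective (φ := Int.castRingHom (ZMod q))
    ZMod.intCast_surjective (z i)
  exact ⟨a, funext ha⟩

theorem layersReduction_eq_zero_iff (q : ℕ)
    (a : ∀ i : Fin (n + 1), ι i →₀ MonoidAlgebra ℤ Gal(layer F K p i/F)) :
    layersReduction F K p ι q a = 0 ↔ ∃ a', a = q • a' := by
  have h (i : Fin (n + 1)) := freeMap_eq_zero_iff (φ := Int.castRingHom (ZMod q)) (q := q)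
    (fun r => by simp [ZMod.intCast_zmod_eq_zero_iff_dvd]) (a i)
  rw [funext_iff]
  refine (forall_congr' h).trans ⟨fun h => ?_, ?_⟩
  · choose a' ha' using h
    exact ⟨a', funext ha'⟩
  · rintro ⟨a', rfl⟩ i
    exact ⟨a' i, rfl⟩

variable (b : ∀ i : Fin (n + 1), ι i → (layer F K p i)ˣ)

/-- The class of an element of `Kˣ` modulo `p ^ m`-th powers. -/
def powerClassMk (p : ℕ) (K : Type v) [Field K] (m : ℕ) : Additive Kˣ →+ PowerClasses p K m :=
  ModN.mkQ (p ^ m)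

theorem powerClassMk_surjective (m : ℕ) : Function.Surjective (powerClassMk p K m) :=
  Submodule.Quotient.mk_surjective _

theorem powerClassMk_eq_zero_iff (m : ℕ) (y : Additive Kˣ) :
    powerClassMk p K m y = 0 ↔ ∃ z, y = p ^ m • z :=
  (Submodule.Quotient.mk_eq_zero _).trans (exists_congr fun z => by
    rw [LinearMap.lsmul_apply, natCast_zsmul, eq_comm])

/-- The identification of a power class module with a product of free modules, compatible with
the homomorphism given by elements of the layers. -/
theorem exists_linearEquiv_powerClasses (m : ℕ)
    (hinj : ∀ a y, layersMap b a = p ^ m • y → ∃ a', a = p ^ m • a')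
    (hsurj : ∀ y, ∃ a z, y = layersMap b a + p ^ m • z) :
    ∃ e : (∀ i : Fin (n + 1), ι i →₀ MonoidAlgebra (ZMod (p ^ m)) Gal(layer F K p i/F)) ≃ₗ[
        ZMod (p ^ m)] PowerClasses p K m,
      ∀ a, e (layersReduction F K p ι (p ^ m) a) = powerClassMk p K m (layersMap b a) := by
  obtain ⟨e₁, h₁⟩ := ModN.exists_linearEquiv (p ^ m) (layersReduction F K p ι (p ^ m))
    (layersReduction_surjective _) (layersReduction_eq_zero_iff _)
  obtain ⟨e₂, h₂⟩ := ModN.exists_linearEquiv (p ^ m)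
    ((powerClassMk p K m).comp (layersMap b)) (fun y => by
      obtain ⟨y, rfl⟩ := powerClassMk_surjective m y
      obtain ⟨a, z, rfl⟩ := hsurj y
      refine ⟨a, ?_⟩
      rw [map_add, (powerClassMk_eq_zero_iff m _).2 ⟨z, rfl⟩, add_zero]
      rfl) (fun a => by
      rw [AddMonoidHom.comp_apply, powerClassMk_eq_zero_iff]
      refine ⟨fun ⟨y, hy⟩ => hinj a y hy, ?_⟩
      rintro ⟨a', rfl⟩
      exact ⟨_, map_nsmul _ _ _⟩)
  refine ⟨e₁.symm ≪≫ₗ e₂, fun a => ?_⟩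
  rw [LinearEquiv.trans_apply, ← h₁, LinearEquiv.symm_apply_apply]
  exact h₂ a

variable {b}

/-- Every element lifts to integral coefficients, where both identifications are induced by the same
`layersMap b`. -/
theorem proj_linearEquiv_powerClasses {m : ℕ}
    (e : (∀ i : Fin (n + 1), ι i →₀ MonoidAlgebra (ZMod (p ^ m)) Gal(layer F K p i/F)) ≃ₗ[
        ZMod (p ^ m)] PowerClasses p K m)
    (he : ∀ a, e (layersReduction F K p ι (p ^ m) a) = powerClassMk p K m (layersMap b a))
    (e' : (∀ i : Fin (n + 1), ι i →₀ MonoidAlgebra (ZMod (p ^ (m + 1))) Gal(layer F K p i/F)) ≃ₗ[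
        ZMod (p ^ (m + 1))] PowerClasses p K (m + 1))
    (he' : ∀ a, e' (layersReduction F K p ι (p ^ (m + 1)) a) =
      powerClassMk p K (m + 1) (layersMap b a))
    (z : ∀ i : Fin (n + 1), ι i →₀ MonoidAlgebra (ZMod (p ^ (m + 1))) Gal(layer F K p i/F)) :
    PowerClasses.proj p K m (e' z) =
      e (fun i => freeMap Gal(layer F K p i/F) (ι i) (zmodPowCast p m) (z i)) := by
  obtain ⟨a, rfl⟩ := layersReduction_surjective _ z
  have h : (fun i : Fin (n + 1) => freeMap Gal(layer F K p i/F) (ι i) (zmodPowCast p m)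
      (layersReduction F K p ι (p ^ (m + 1)) a i)) = layersReduction F K p ι (p ^ m) a :=
    funext fun i => (freeMap_freeMap _ _ _).trans (by
      rw [RingHom.ext_int (RingHom.comp _ _) (Int.castRingHom (ZMod (p ^ m)))]
      rfl)
  rw [h, he, he']
  rfl

/-- The identification of a representation with a finite direct sum given by an identification
with a product. -/
def _root_.Representation.directSumEquiv {k G ι : Type*} [CommRing k] [Group G] [Fintype ι]
    [DecidableEq ι] {V : ι → Type*}
    {W : Type*} [∀ i, AddCommGroup (V i)] [∀ i, Module k (V i)] [AddCommGroup W] [Module k W]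
    (ρ : ∀ i, Representation k G (V i)) (τ : Representation k G W) (e : (∀ i, V i) ≃ₗ[k] W)
    (he : ∀ g z, e (fun i => ρ i g (z i)) = τ g (e z)) : τ.Equiv (directSum ρ) :=
  Representation.Equiv.symm (.mk (DirectSum.linearEquivFunOnFintype k ι V ≪≫ₗ e) fun g =>
    LinearMap.ext fun _ =>
    (congrArg e (funext fun _ => rfl)).trans (he g _))

theorem exists_linearEquiv_powerClassesLimit [Fact p.Prime]
    (e : ∀ m, (∀ i : Fin (n + 1), ι i →₀ MonoidAlgebra (ZMod (p ^ m)) Gal(layer F K p i/F)) ≃ₗ[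
        ZMod (p ^ m)] PowerClasses p K m)
    (he : ∀ m a, e m (layersReduction F K p ι (p ^ m) a) = powerClassMk p K m (layersMap b a)) :
    ∃ E : (∀ i : Fin (n + 1), FreeCompletion p Gal(layer F K p i/F) (ι i)) ≃ₗ[ℤ_[p]]
        PowerClassesLimit p K,
      ∀ y m, (E y).1 m = e m fun i => completionMap p Gal(layer F K p i/F) (ι i) m (y i) := by
  let E : (∀ i : Fin (n + 1), FreeCompletion p Gal(layer F K p i/F) (ι i)) →ₗ[ℤ_[p]]
      PowerClassesLimit p K :=
    { toFun y := ⟨fun m => e m fun i => completionMap p Gal(layer F K p i/F) (ι i) m (y i),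
        fun m => by
          rw [proj_linearEquiv_powerClasses (e m) (he m) (e (m + 1)) (he (m + 1))]
          exact congrArg (e m) (funext fun i => freeMap_completionMap m (y i))⟩
      map_add' x y := Subtype.ext <| funext fun m =>
        (congrArg (e m) (funext fun i => map_add
          (completionMap p Gal(layer F K p i/F) (ι i) m) (x i) (y i))).trans (map_add (e m) _ _)
      map_smul' r y := Subtype.ext <| funext fun m =>
        (congrArg (e m) (funext fun i =>
          (completionMap p Gal(layer F K p i/F) (ι i) m).map_smulₛₗ r (y i))).trans
          (map_smul (e m) (PadicInt.toZModPow m r) _) }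
  refine ⟨LinearEquiv.ofBijective E ⟨fun x y hxy => funext fun i => ext_completionMap fun m => ?_,
    fun x => ?_⟩, fun y m => rfl⟩
  · have h : (E x).1 m = (E y).1 m := by rw [hxy]
    exact congrFun ((e m).injective h) i
  -- The components of a point of $J_\infty$, pulled back along the `e m`, form compatible systems,
  -- which come from the completions.
  · have hx (m : ℕ) (i : Fin (n + 1)) :
        freeMap Gal(layer F K p i/F) (ι i) (zmodPowCast p m) ((e (m + 1)).symm (x.1 (m + 1)) i) =
          (e m).symm (x.1 m) i := by
      refine congrFun (f := fun i : Fin (n + 1) =>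
        freeMap Gal(layer F K p i/F) (ι i) (zmodPowCast p m)
        ((e (m + 1)).symm (x.1 (m + 1)) i)) ((e m).injective ?_) i
      rw [← proj_linearEquiv_powerClasses (e m) (he m) (e (m + 1)) (he (m + 1)),
        LinearEquiv.apply_symm_apply, LinearEquiv.apply_symm_apply]
      exact x.2 m
    choose y hy using fun i : Fin (n + 1) =>
      exists_completionMap_eq (fun m => (e m).symm (x.1 m) i) fun m => hx m i
    refine ⟨y, Subtype.ext <| funext fun m => ?_⟩
    exact (congrArg (e m) (funext fun i => hy i m)).trans ((e m).apply_symm_apply _)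

variable [IsGalois F K] [IsCyclic Gal(K/F)]

theorem layersMap_smul (g : Gal(K/F))
    (a : ∀ i : Fin (n + 1), ι i →₀ MonoidAlgebra ℤ Gal(layer F K p i/F)) :
    layersMap b (fun i => inflate (free ℤ Gal(layer F K p i/F) (ι i)) g (a i)) =
      ofMulDistribMulAction Gal(K/F) Kˣ g (layersMap b a) := by
  rw [layersMap_apply, layersMap_apply, map_sum]
  exact Finset.sum_congr rfl fun i _ => layerMap_apply _ _ _

theorem linearEquiv_powerClasses_smul {m : ℕ}
    (e : (∀ i : Fin (n + 1), ι i →₀ MonoidAlgebra (ZMod (p ^ m)) Gal(layer F K p i/F)) ≃ₗ[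
        ZMod (p ^ m)] PowerClasses p K m)
    (he : ∀ a, e (layersReduction F K p ι (p ^ m) a) = powerClassMk p K m (layersMap b a))
    (g : Gal(K/F))
    (z : ∀ i : Fin (n + 1), ι i →₀ MonoidAlgebra (ZMod (p ^ m)) Gal(layer F K p i/F)) :
    e (fun i => inflate (free (ZMod (p ^ m)) Gal(layer F K p i/F) (ι i)) g (z i)) =
      powerClassesRep p F K m g (e z) := by
  obtain ⟨a, rfl⟩ := layersReduction_surjective _ z
  have h : (fun i : Fin (n + 1) => inflate (free (ZMod (p ^ m)) Gal(layer F K p i/F) (ι i)) g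
      (layersReduction F K p ι (p ^ m) a i)) = layersReduction F K p ι (p ^ m)
        (fun i => inflate (free ℤ Gal(layer F K p i/F) (ι i)) g (a i)) :=
    funext fun i => (freeMap_apply _ _ _).symm
  rw [h, he, he, layersMap_smul]
  rfl

end CyclicModule

end

/-! ### The decomposition theorem -/

open CyclicModule Representation in
theorem theorem3 (p : ℕ) [Fact p.Prime] (n : ℕ)
    (F : Type u) (K : Type v) [Field F] [Field K] [Algebra F K]
    [FiniteDimensional F K] [IsGalois F K] [IsCyclic Gal(K/F)]
    (hdeg : Module.finrank F K = p ^ n)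
    (hF : ∀ ζ : F, ¬ IsPrimitiveRoot ζ p) :
    ∃ (Y : Fin (n + 1) → Type (max u v)) (_ : ∀ i, AddCommGroup (Y i))
      (_ : ∀ i, Module ℤ_[p] (Y i))
      (τ : ∀ i : Fin (n + 1), Representation ℤ_[p] Gal(layer F K p (i : ℕ)/F) (Y i)),
      (∀ i, (τ i).IsTopologicallyFreeOfRank p (normRank F K p n i)) ∧
      (∀ i : Fin (n + 1), normRank F K p n i < ℵ₀ → (τ i).IsFreeOfRank (normRank F K p n i)) ∧
      Nonempty ((powerClassesLimitRep p F K).Equiv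
        (Representation.directSum fun i : Fin (n + 1) => inflate (τ i))) ∧
      ∀ m : ℕ, 1 ≤ m →
        Nonempty ((powerClassesRep p F K m).Equiv
          (Representation.directSum fun i : Fin (n + 1) => inflate ((τ i).modN (p ^ m)))) ∧
        ∀ i, ((τ i).modN (p ^ m)).IsFreeOfRank (normRank F K p n i) := by
  obtain ⟨σ, hσ⟩ := IsCyclic.exists_generator (α := Gal(K/F))
  obtain ⟨ι, b, hι, hb⟩ := exists_isNormBasis F K p n hdeg hσ
  let _ := unitsModule σ
  have hbij := bijective_mod_pow (layersMap b) (p := p)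
    (fun x hx => (isHilbertModule_units Fact.out hdeg hF hσ).torsionFree x (by
      rw [Nat.cast_smul_eq_nsmul, hx]))
    (exists_eq_nsmul_of_layersMap_eq hdeg hF hσ hb) (exists_eq_layersMap_add hdeg hF hσ hb)
  choose e he using fun m => exists_linearEquiv_powerClasses b m (hbij m).1 (hbij m).2
  obtain ⟨E, hE⟩ := exists_linearEquiv_powerClassesLimit e he
  refine ⟨fun i => FreeCompletion p Gal(layer F K p i/F) (ι i), fun i => inferInstance,
    fun i => inferInstance, fun i => freeCompletion p Gal(layer F K p i/F) (ι i),
    fun i => ⟨ι i, hι i, ⟨.refl _⟩⟩, fun i hi => ?_, ⟨?_⟩, fun m _ => ?_⟩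
  · rw [← hι] at hi ⊢
    have : Finite (ι i) := Cardinal.lt_aleph0_iff_finite.1 hi
    exact isFreeOfRank_freeCompletion
  · refine directSumEquiv _ _ E fun g y => Subtype.ext (funext fun m => ?_)
    refine (hE _ m).trans ?_
    refine Eq.trans ?_ ((linearEquiv_powerClasses_smul (e m) (he m) g _).trans
      (congrArg (powerClassesRep p F K m g) (hE y m).symm))
    exact congrArg (e m) (funext fun i => completionMap_apply m _ (y i))
  · choose ε _ using fun i : Fin (n + 1) =>
      exists_modN_freeCompletion_equiv p Gal(layer F K p i/F) (ι i) m
    -- Each $Y_i/p^mY_i$ is the free module over $(\mathbb Z/p^m)[G_i]$ on $\iota_i$, so `e m` gives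
    -- the decomposition of $J_m$.
    refine ⟨⟨directSumEquiv _ _
      (LinearEquiv.piCongrRight (fun i => (ε i).toLinearEquiv) ≪≫ₗ e m) fun g y => ?_⟩,
      fun i => hι i ▸ (isFreeOfRank_free _ _ (ι i)).of_equiv (ε i)⟩
    refine Eq.trans ?_ (linearEquiv_powerClasses_smul (e m) (he m) g _)
    exact congrArg (e m) (funext fun i => LinearMap.congr_fun ((ε i).isIntertwining' _) (y i))
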